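/- Let $V$ be a locally presentable category whose initial object $\emptyset$ is strict (every morphism into $\emptyset$ is invertible). Let $\mathcal{G}V$ be the category of $V$-graphs: an object $X$ is a small set $X_{\mathrm{ob}}$ of objects with an object $X(a,b)$ of $V$ for all $a,b\in X_{\mathrm{ob}}$, and a morphism is a function on objects together with morphisms on homs. It lies over $\mathbf{Set}$ by taking sets of objects. Let $T$ be a monad on $\mathcal{G}V$ over $\mathbf{Set}$ (the underlying functor commutes with the functor to $\mathbf{Set}$, and the unit and multiplication are identities on objects) which is accessible, preserves small coproducts and is well-pointed: $T0$ is terminal, where $0$ is the $V$-graph with one object and hom $\emptyset$. Regard $\mathcal{G}(V)^T$ as a category over $\mathbf{Set}$ by taking sets of objects. For a category $A$ over $\mathbf{Set}$, with $|a|$ the underlying set of $a\in A$, let $\mathcal{F}A$ be the symmetric multicategory with the objects of $A$ in which a multimap $f:(a_1,\dots,a_n)\to b$ consists of a function $f_0:\prod_i|a_i|\to|b|$ and, for each $j$ and each $z\in\prod_{i\ne j}|a_i|$, a morphism $f_z:a_j\to b$ of $A$ lying over the function obtained from $f_0$ by fixing the variables other than the $j$-th at $z$. Composition is substitution of the functions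 $f_0$ and composition of the morphisms $f_z$. A multimap $u:(a_1,\dots,a_n)\to P$ is strongly universal if, for every sequence of objects having $P$ among its entries and every object $c$, composition with $u$ at $P$ is a bijection from the multimaps from this sequence to $c$ onto the multimaps to $c$ from the sequence in which $P$ is replaced by $a_1,\dots,a_n$. A free product of $T$-algebras $X_1,\dots,X_n$ is the codomain of a strongly universal multimap out of $(X_1,\dots,X_n)$ in $\mathcal{F}(\mathcal{G}(V)^T)$. For a $T$-algebra $X$ let $X_0$ be the coproduct in $\mathcal{G}(V)^T$ of copies of the terminal algebra $1$ indexed by the morphisms $1\to X$, and let $i_X:X_0\to X$ be the morphism whose component at $x:1\to X$ is $x$. Then for all $n\ge 0$ and all $T$-algebras $X_1,\dots,X_n$ the free product of $X_1,\dots,X_n$ exists, and it is the width-$n$ pushout in $\mathcal{G}(V)^T$ of the $n$ morphisms $$\prod_i \mathrm{id}|_j\, i_{X_j}\;:\;\prod_i X_{i,0}\longrightarrow \prod_i X_{i,0}|_jX_j\qquad(1\le j\le n),$$ where $|_j$ means that the $j$-th entry is replaced by the one indicated. More precisely, for every strongly universal $u:(X_1,\dots,X_n)\to P$ there is a colimit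 cocone with vertex $P$ on this diagram whose leg at $j$, restricted along the morphism $X_j\to\prod_iX_{i,0}|_jX_j$ given by objects $z_i$ of $X_i$ for $i\neq j$, is $u_z$, and whose leg at $\prod_iX_{i,0}$ acts as $u_0$ on objects. -/

import Mathlib

open CategoryTheory CategoryTheory.Limits

universe v u

namespace FreeProducts

/-! ### Locally presentable categories are complete -/

section Complete

variable (V : Type u) [Category.{v} V] [IsLocallyPresentable.{v} V]

instance hasColimits_of_isLocallyPresentable : HasColimitsOfSize.{v, v} V := by
  obtain ⟨κ, _, _⟩ := IsLocallyPresentable.exists_cardinal.{v} V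
  infer_instance

instance hasLimits_of_isLocallyPresentable : HasLimitsOfSize.{v, v} V := by
  obtain ⟨κ, _, _⟩ := IsLocallyPresentable.exists_cardinal.{v} V
  let F : SmallModel.{v} (isCardinalPresentable V κ).FullSubcategory ⥤ V :=
    (equivSmallModel.{v} _).inverse ⋙ (isCardinalPresentable V κ).ι
  have : F.IsDense := inferInstance
  have : (uliftYoneda.{v} : _ ⥤
      (SmallModel.{v} (isCardinalPresentable V κ).FullSubcategory)ᵒᵖ ⥤
        Type v).HasPointwiseLeftKanExtension F := inferInstance
  let _ : Reflective (Presheaf.restrictedULiftYoneda.{v} F) :=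
    { L := _
      adj := Presheaf.uliftYonedaAdjunction.{v} _ (uliftYoneda.{v}.leftKanExtensionUnit F) }
  exact hasLimits_of_reflective (Presheaf.restrictedULiftYoneda.{v} F)

end Complete

/-! ### Graphs enriched in `V` -/

/-- A graph enriched in `V`: a small set of objects, and an object of `V` for each ordered pair of
objects. No composition or identities. -/
structure VGraph (V : Type u) [Category.{v} V] : Type (max u (v + 1)) where
  /-- the set of objects -/
  Ob : Type v
  /-- the homs -/
  hom : Ob → Ob → V

namespace VGraph

variable {V : Type u} [Category.{v} V]

/-- A morphism of `V`-graphs: an object map together with hom maps. -/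
structure Hom (X Y : VGraph V) : Type v where
  /-- the object map -/
  onOb : X.Ob → Y.Ob
  /-- the hom maps -/
  onHom : ∀ a b : X.Ob, X.hom a b ⟶ Y.hom (onOb a) (onOb b)

/-- The category `𝒢V` of `V`-graphs. -/
instance : Category.{v} (VGraph V) where
  Hom := Hom
  id X := ⟨fun a => a, fun _ _ => 𝟙 _⟩
  comp f g := ⟨fun a => g.onOb (f.onOb a), fun a b => f.onHom a b ≫ g.onHom _ _⟩
  id_comp f := by simp
  comp_id f := by simp
  assoc f g h := by simp

@[simp] lemma id_onOb (X : VGraph V) (a : X.Ob) : Hom.onOb (𝟙 X) a = a := rfl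

@[simp] lemma id_onHom (X : VGraph V) (a b : X.Ob) : Hom.onHom (𝟙 X) a b = 𝟙 _ := rfl

@[simp] lemma comp_onOb {X Y Z : VGraph V} (f : X ⟶ Y) (g : Y ⟶ Z) (a : X.Ob) :
    Hom.onOb (f ≫ g) a = Hom.onOb g (Hom.onOb f a) := rfl

@[simp] lemma comp_onHom {X Y Z : VGraph V} (f : X ⟶ Y) (g : Y ⟶ Z) (a b : X.Ob) :
    Hom.onHom (f ≫ g) a b = Hom.onHom f a b ≫ Hom.onHom g _ _ := rfl

lemma hom_ext {X Y : VGraph V} {f g : X ⟶ Y} (h₀ : ∀ a, Hom.onOb f a = Hom.onOb g a)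
    (h₁ : ∀ a b, Hom.onHom f a b ≫ eqToHom (by rw [h₀, h₀]) = Hom.onHom g a b) : f = g := by
  obtain ⟨f₀, f₁⟩ := f
  obtain ⟨g₀, g₁⟩ := g
  obtain rfl : f₀ = g₀ := funext h₀
  congr 1
  funext a b
  simpa using h₁ a b

/-- The functor `𝒢V ⥤ Set` sending a graph to its set of objects. -/
def ob (V : Type u) [Category.{v} V] : VGraph V ⥤ Type v where
  obj X := X.Ob
  map f := ↾(Hom.onOb f)

/-- The graph `0`: one object, with initial hom. -/
noncomputable def zero (V : Type u) [Category.{v} V] [HasInitial V] : VGraph V where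
  Ob := PUnit
  hom _ _ := ⊥_ V

/-! #### Products of `V`-graphs -/

section Products

variable {J : Type} [HasProductsOfShape J V] (X : J → VGraph V)

/-- The product of a family of graphs. -/
noncomputable def prod : VGraph V where
  Ob := ∀ j, (X j).Ob
  hom a b := ∏ᶜ fun j => (X j).hom (a j) (b j)

/-- The projections of the product. -/
noncomputable def prodProj (j : J) : prod X ⟶ X j :=
  (⟨fun a => a j, fun _ _ => Pi.π _ j⟩ : Hom (prod X) (X j))

/-- The morphism into the product with given components. -/
noncomputable def prodLift {Y : VGraph V} (f : ∀ j, Y ⟶ X j) : Y ⟶ prod X :=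
  (⟨fun a j => Hom.onOb (f j) a, fun a b => Pi.lift fun j => Hom.onHom (f j) a b⟩ :
    Hom Y (prod X))

lemma prodLift_proj {Y : VGraph V} (f : ∀ j, Y ⟶ X j) (j : J) :
    prodLift X f ≫ prodProj X j = f j := by
  refine hom_ext (fun a => rfl) fun a b => ?_
  refine (Category.comp_id _).trans ?_
  exact Pi.lift_π (fun j => Hom.onHom (f j) a b) j

lemma prodLift_comp_proj {Y : VGraph V} (m : Y ⟶ prod X) :
    prodLift X (fun j => m ≫ prodProj X j) = m := by
  refine hom_ext (fun a => rfl) fun a b => ?_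
  refine (Category.comp_id _).trans ?_
  refine Pi.hom_ext _ _ fun j => ?_
  exact Pi.lift_π (fun j => Hom.onHom (m ≫ prodProj X j) a b) j

/-- The product fan is limiting. -/
noncomputable def prodIsLimit : IsLimit (Fan.mk (prod X) (prodProj X)) :=
  Fan.IsLimit.mk _ (fun s => prodLift X s.proj) (fun s j => prodLift_proj X s.proj j)
    (fun s m hm => by
      have h : (fun j => m ≫ prodProj X j) = s.proj := funext hm
      rw [← h]
      exact (prodLift_comp_proj X m).symm)

instance : HasProductsOfShape J (VGraph V) where
  has_limit F :=
    have : HasLimit (Discrete.functor (F.obj ∘ Discrete.mk)) := ⟨_, prodIsLimit _⟩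
    hasLimit_of_iso Discrete.natIsoFunctor.symm

end Products

instance [HasLimitsOfSize.{v, v} V] : HasFiniteProducts (VGraph V) where
  out _ := inferInstance

/-! #### Coproducts of `V`-graphs -/

section Coproducts

lemma eqToHom_comp_eqToHom_comp {P Q R : V} (h : P = Q) (f : Q ⟶ R) :
    eqToHom h.symm ≫ eqToHom h ≫ f = f := by
  subst h
  simp

open Classical in
/-- The homs of a coproduct of graphs: initial between different summands. -/
noncomputable def coprodHom [HasInitial V] {J : Type v} (X : J → VGraph V)
    (a b : Σ j, (X j).Ob) : V :=
  if h : a.1 = b.1 then (X b.1).hom (h ▸ a.2) b.2 else ⊥_ V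

variable [HasInitial V] {J : Type v} (X : J → VGraph V)

lemma coprodHom_same (j : J) (a b : (X j).Ob) :
    coprodHom X ⟨j, a⟩ ⟨j, b⟩ = (X j).hom a b := by
  simp [coprodHom]

lemma coprodHom_ne {a b : Σ j, (X j).Ob} (h : a.1 ≠ b.1) : coprodHom X a b = ⊥_ V := by
  simp [coprodHom, h]

/-- The coproduct of a family of graphs. -/
noncomputable def coprod : VGraph V where
  Ob := Σ j, (X j).Ob
  hom := coprodHom X

/-- The inclusions of the coproduct. -/
noncomputable def coprodIncl (j : J) : X j ⟶ coprod X :=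
  (⟨fun a => ⟨j, a⟩, fun a b => eqToHom (coprodHom_same X j a b).symm⟩ : Hom (X j) (coprod X))

open Classical in
/-- The morphism out of the coproduct with given components. -/
noncomputable def coprodDesc {Y : VGraph V} (f : ∀ j, X j ⟶ Y) : coprod X ⟶ Y :=
  (⟨fun a => Hom.onOb (f a.1) a.2, fun a b =>
    if h : a.1 = b.1 then
      eqToHom (by obtain ⟨j, a⟩ := a; obtain ⟨k, b⟩ := b; obtain rfl : j = k := h
                  exact coprodHom_same X j a b) ≫
        Hom.onHom (f b.1) (h ▸ a.2) b.2 ≫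
          eqToHom (by obtain ⟨j, a⟩ := a; obtain ⟨k, b⟩ := b; obtain rfl : j = k := h; rfl)
    else eqToHom (coprodHom_ne X h) ≫ initial.to _⟩ : Hom (coprod X) Y)

lemma coprodDesc_onHom_same {Y : VGraph V} (f : ∀ j, X j ⟶ Y) (j : J) (a b : (X j).Ob) :
    Hom.onHom (coprodDesc X f) ⟨j, a⟩ ⟨j, b⟩ =
      eqToHom (coprodHom_same X j a b) ≫ Hom.onHom (f j) a b := by
  simp only [coprodDesc, dif_pos]
  exact congrArg _ (Category.comp_id _)

lemma coprodIncl_desc {Y : VGraph V} (f : ∀ j, X j ⟶ Y) (j : J) :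
    coprodIncl X j ≫ coprodDesc X f = f j := by
  refine hom_ext (fun a => rfl) fun a b => ?_
  refine (Category.comp_id _).trans ?_
  refine (congrArg (eqToHom (coprodHom_same X j a b).symm ≫ ·)
    (coprodDesc_onHom_same X f j a b)).trans ?_
  exact eqToHom_comp_eqToHom_comp (coprodHom_same X j a b) _

lemma coprodDesc_incl_comp {Y : VGraph V} (m : coprod X ⟶ Y) :
    coprodDesc X (fun j => coprodIncl X j ≫ m) = m := by
  refine hom_ext (fun a => rfl) fun a b => ?_
  refine (Category.comp_id _).trans ?_
  by_cases h : a.1 = b.1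
  · obtain ⟨j, a⟩ := a
    obtain ⟨k, b⟩ := b
    obtain rfl : j = k := h
    refine (coprodDesc_onHom_same X _ j a b).trans ?_
    exact eqToHom_comp_eqToHom_comp (coprodHom_same X j a b).symm (Hom.onHom m ⟨j, a⟩ ⟨j, b⟩)
  · exact (initialIsInitial.ofIso (eqToIso (coprodHom_ne X h).symm)).hom_ext _ _

/-- The coproduct cofan is colimiting. -/
noncomputable def coprodIsColimit : IsColimit (Cofan.mk (coprod X) (coprodIncl X)) :=
  Cofan.IsColimit.mk _ (fun s => coprodDesc X s.inj) (fun s j => coprodIncl_desc X s.inj j)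
    (fun s m hm => by
      have h : (fun j => coprodIncl X j ≫ m) = s.inj := funext hm
      rw [← h]
      exact (coprodDesc_incl_comp X m).symm)

instance : HasCoproductsOfShape J (VGraph V) where
  has_colimit F :=
    have : HasColimit (Discrete.functor (F.obj ∘ Discrete.mk)) := ⟨_, coprodIsColimit _⟩
    hasColimit_of_iso Discrete.natIsoFunctor

end Coproducts

end VGraph

/-! ### The symmetric multicategory of a category over `Set` -/

section Multimaps

variable {A : Type u} [Category.{v} A] (p : A ⥤ Type v)

/-- `plug i s z` is the tuple with `i`-th entry `s` and whose other entries are those of `z`. -/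
def plug {ι : Type} [DecidableEq ι] {S : ι → Type v} (i : ι) (s : S i)
    (z : ∀ k : {k // k ≠ i}, S k) : ∀ k, S k :=
  fun k => if h : k = i then h.symm ▸ s else z ⟨k, h⟩

/-- A multimap `(a i)ᵢ → b` in the symmetric multicategory `ℱA` of a category `p : A ⥤ Set`
over `Set`: a function `fn` in several variables between the underlying sets and, for each
variable `i` and each choice `z` of elements for the other variables, a morphism
`lin i z : a i ⟶ b` of `A` lying over the function obtained from `fn` by fixing the other
variables at `z`. -/
structure Multimap {ι : Type} [DecidableEq ι] (a : ι → A) (b : A) where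
  /-- the underlying multifunction -/
  fn : (∀ i, p.obj (a i)) → p.obj b
  /-- the linear parts -/
  lin : ∀ i, (∀ k : {k // k ≠ i}, p.obj (a k)) → (a i ⟶ b)
  lin_fn : ∀ i z s, p.map (lin i z) s = fn (plug i s z)

namespace Multimap

variable {p} {ι κ : Type} [DecidableEq ι] [DecidableEq κ]

/-- Placed composition in `ℱA`: a multimap `f : (P, (y k)ₖ) → c` is composed, in its distinguished
variable `none`, with a multimap `u : (a i)ᵢ → P`; the result is a multimap
`((y k)ₖ, (a i)ᵢ) → c`. -/
def placed {y : κ → A} {a : ι → A} {P c : A}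
    (f : Multimap p (fun o : Option κ => o.elim P y) c) (u : Multimap p a P) :
    Multimap p (Sum.elim y a) c where
  fn t := f.fn fun o => match o with
    | none => u.fn fun i => t (Sum.inr i)
    | some k => t (Sum.inl k)
  lin j := match j with
    | Sum.inl k => fun w => f.lin (some k) fun o => match o with
      | ⟨none, _⟩ => u.fn fun i => w ⟨Sum.inr i, Sum.inr_ne_inl⟩
      | ⟨some k', h⟩ => w ⟨Sum.inl k', fun e => h (congrArg some (Sum.inl_injective e))⟩
    | Sum.inr i => fun w =>
      u.lin i (fun i' => w ⟨Sum.inr i', fun e => i'.2 (Sum.inr_injective e)⟩) ≫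
        f.lin none fun o => match o with
          | ⟨none, h⟩ => absurd rfl h
          | ⟨some k, _⟩ => w ⟨Sum.inl k, Sum.inl_ne_inr⟩
  lin_fn j := by
    rcases j with k | i
    · intro w s
      refine (f.lin_fn (some k) _ s).trans (congrArg f.fn (funext fun o => ?_))
      rcases o with _ | k'
      · rfl
      · by_cases h : k' = k
        · subst h
          simp [plug]
          rfl
        · simp [plug, h]
          rfl
    · intro w s
      refine (p.map_comp_apply _ _ s).trans ?_
      refine (f.lin_fn none _ _).trans (congrArg f.fn (funext fun o => ?_))
      rcases o with _ | k
      · refine (u.lin_fn i _ s).trans (congrArg u.fn (funext fun i' => ?_))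
        by_cases h : i' = i
        · subst h
          simp [plug]
          rfl
        · simp [plug, h]
          rfl
      · rfl

/-- A multimap `u : (a i)ᵢ → P` is strongly universal when placed composition with `u` is a
bijection from multimaps having `P` among their inputs to multimaps having instead the `a i` among
their inputs. As `ℱA` is symmetric, the place of `P` among the inputs is immaterial. -/
def StronglyUniversal {a : ι → A} {P : A} (u : Multimap p a P) : Prop :=
  ∀ (m : ℕ) (y : Fin m → A) (c : A), Function.Bijective
    fun f : Multimap p (fun o : Option (Fin m) => o.elim P y) c => f.placed u

end Multimap

end Multimaps

/-! ### The width-`n` pushout diagram -/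

section Span

variable {A : Type u} [Category.{v} A] [HasFiniteProducts A] [HasCoproducts.{v} A]

/-- The object `a₀ = A(1, a) · 1`, the copower of the terminal object by the elements of `a`. -/
noncomputable def disc (a : A) : A := ∐ fun _ : (⊤_ A) ⟶ a => ⊤_ A

/-- The canonical morphism `a₀ ⟶ a`, whose component at `x : 1 ⟶ a` is `x`. -/
noncomputable def discι (a : A) : disc a ⟶ a := Sigma.desc fun x => x

variable {n : ℕ} (a : Fin n → A)

/-- The family obtained from `(aᵢ₀)ᵢ` by replacing the `j`-th entry by `a j`. -/
noncomputable def repl (j i : Fin n) : A := if i = j then a i else disc (a i)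

/-- The morphisms which are the canonical one `aⱼ₀ ⟶ aⱼ` at `j` and identities elsewhere. -/
noncomputable def replMap (j i : Fin n) : disc (a i) ⟶ repl a j i :=
  if h : i = j then discι (a i) ≫ eqToHom (if_pos h).symm else eqToHom (if_neg h).symm

/-- The diagram of the `n` morphisms `∏ᵢ aᵢ₀ ⟶ ∏ᵢ aᵢ₀|ⱼaⱼ`, for `j : Fin n`; a colimit of it is a
width-`n` pushout. -/
noncomputable def pushoutDiagram : WidePushoutShape (Fin n) ⥤ A :=
  WidePushoutShape.wideSpan (∏ᶜ fun i => disc (a i)) (fun j => ∏ᶜ repl a j)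
    fun j => Limits.Pi.map (replMap a j)

/-- The morphism `a j ⟶ ∏ᵢ aᵢ₀|ⱼaⱼ` with `j`-th component the identity and `i`-th component, for
`i ≠ j`, constant at the coproduct inclusion indexed by the element `x i` of `a i`. -/
noncomputable def insertAt (j : Fin n) (x : ∀ i : {i // i ≠ j}, (⊤_ A) ⟶ a i) :
    a j ⟶ ∏ᶜ repl a j :=
  Pi.lift fun i =>
    if h : i = j then eqToHom (by subst h; exact (if_pos rfl).symm)
    else (terminal.from (a j) ≫ Sigma.ι (fun _ : (⊤_ A) ⟶ a i => ⊤_ A) (x ⟨i, h⟩)) ≫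
      eqToHom (if_neg h).symm

/-- The element of `∏ᵢ aᵢ₀` given by a tuple of elements. -/
noncomputable def point (x : ∀ i, (⊤_ A) ⟶ a i) : (⊤_ A) ⟶ ∏ᶜ fun i => disc (a i) :=
  Pi.lift fun i => Sigma.ι (fun _ : (⊤_ A) ⟶ a i => ⊤_ A) (x i)

variable (p : A ⥤ Type v)

/-- A global element `x : 1 ⟶ b` names an element `s` of the underlying set of `b` if it sends
an element of the underlying set of `1` to `s`. -/
def Names {b : A} (x : (⊤_ A) ⟶ b) (s : p.obj b) : Prop := ∃ t, p.map x t = s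

variable {p} {a}

/-- The multimap `u : (aᵢ)ᵢ → P` corresponds to the cocone `c` with vertex `P` on the diagram: the
linear parts of `u` are the restrictions of the legs of `c` along the morphisms `insertAt`, and its
underlying multifunction is the action on elements of the leg at `∏ᵢ aᵢ₀`. -/
def Corresponds {P : A} (u : Multimap p a P) (c : pushoutDiagram a ⟶ (Functor.const _).obj P) : Prop :=
  (∀ (j : Fin n) (x : ∀ i : {i // i ≠ j}, (⊤_ A) ⟶ a i) (z : ∀ i : {i // i ≠ j}, p.obj (a i)),
    (∀ i, Names p (x i) (z i)) → insertAt a j x ≫ c.app (some j) = u.lin j z) ∧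
  ∀ (x : ∀ i, (⊤_ A) ⟶ a i) (z : ∀ i, p.obj (a i)),
    (∀ i, Names p (x i) (z i)) → Names p (point a x ≫ c.app none) (u.fn z)

end Span

/-! ### Monads on `𝒢V` over `Set` -/

section Monads

open VGraph

variable {V : Type u} [Category.{v} V] (T : Monad (VGraph V))

/-- `T` is a monad on `𝒢V` over `Set`: its functor commutes with the functor `ob` sending a graph
to its set of objects, and its unit and multiplication are identities on objects. -/
structure IsOverSet : Prop where
  comp_ob : T.toFunctor ⋙ ob V = ob V
  η_ob : ∀ X, (ob V).map (T.η.app X) = eqToHom (Functor.congr_obj comp_ob X).symm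
  μ_ob : ∀ X, (ob V).map (T.μ.app X) = eqToHom (Functor.congr_obj comp_ob (T.obj X))

/-- `T` is well-pointed: `T0 = 1`. -/
def IsWellPointed [HasInitial V] : Prop := Nonempty (IsTerminal (T.obj (zero V)))

/-- `𝒢(V)ᵀ` as a category over `Set`: the set of objects of the underlying graph. -/
abbrev algOb : T.Algebra ⥤ Type v := T.forget ⋙ ob V

instance [HasLimitsOfSize.{v, v} V] : HasFiniteProducts T.Algebra where
  out _ := hasLimitsOfShape_of_hasLimitsOfShape_createsLimitsOfShape T.forget

instance [HasInitial V] (J : Type v) [PreservesColimitsOfShape (Discrete J) T.toFunctor] :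
    HasCoproductsOfShape J T.Algebra :=
  hasColimitsOfShape_of_hasColimitsOfShape_createsColimitsOfShape T.forget

end Monads

end FreeProducts

open FreeProducts

/-! A cocone on the pushout diagram and a multimap out of `(X₁, …, Xₙ)` are the same data. Since `T0
= 1`, the free algebra on the graph `0` is terminal; as it also represents the set of objects, the
objects of an algebra are its global points (`elementsArePoints_algOb`), and `disc X` is a discrete
algebra on the objects of `X`. Since `T` preserves coproducts, coproducts of algebras are disjoint
unions of graphs, with initial homs between different summands. A product of homs with one initial
factor is again initial, by strictness. Hence `∏ᵢ Xᵢ₀` is a coproduct of copies of `1` indexed by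
the tuples of points (`nonempty_isColimit_point`), and `∏ᵢ Xᵢ₀|ⱼXⱼ` is a coproduct of copies of `Xⱼ`
indexed by the tuples of points at the places other than `j` (`nonempty_isColimit_insertAt`).

A leg at `∏ᵢ Xᵢ₀` is therefore a function of `n` variables, a leg at `j` is a family of linear parts
in the variable `j`, and commutation with the diagram is the condition `lin_fn`. So a cocone is a
colimit exactly when its multimap is universal among multimaps out of `(X₁, …, Xₙ)`
(`Corresponds.nonempty_isColimit_iff`).

Two points remain. The colimit exists because algebras for an accessible monad on a cocomplete
category are cocomplete (`hasColimits_algebra`): they form a reflective subcategory of a cocomplete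
category of partial algebras. Universality implies strong universality
(`Universal.stronglyUniversal`) because every set underlies an indiscrete algebra, into which
multimaps are mere functions; this forces `u.fn` to be bijective, and the remaining variables can
then be carried along as parameters. -/

namespace FreeProducts

/-! ### Monad laws with uniform source and target -/

section MonadLemmas

variable {E : Type u} [Category.{v} E] (T : Monad E)

/-- The components of the unit of a monad, with plain source and target. -/
def unitApp (X : E) : X ⟶ T.obj X := T.η.app X

/-- The components of the multiplication of a monad, with plain source and target. -/
def multApp (X : E) : T.obj (T.obj X) ⟶ T.obj X := T.μ.app X

lemma unitApp_naturality {X Y : E} (f : X ⟶ Y) : unitApp T X ≫ T.map f = f ≫ unitApp T Y :=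
  (T.η.naturality f).symm

lemma unitApp_naturality_assoc {X Y Z : E} (f : X ⟶ Y) (h : T.obj Y ⟶ Z) :
    unitApp T X ≫ T.map f ≫ h = f ≫ unitApp T Y ≫ h := by
  rw [← Category.assoc, unitApp_naturality, Category.assoc]

lemma multApp_naturality {X Y : E} (f : X ⟶ Y) :
    T.map (T.map f) ≫ multApp T Y = multApp T X ≫ T.map f :=
  T.μ.naturality f

lemma multApp_naturality_assoc {X Y Z : E} (f : X ⟶ Y) (h : T.obj Y ⟶ Z) :
    T.map (T.map f) ≫ multApp T Y ≫ h = multApp T X ≫ T.map f ≫ h := by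
  rw [← Category.assoc, multApp_naturality, Category.assoc]

lemma unitApp_multApp (X : E) : unitApp T (T.obj X) ≫ multApp T X = 𝟙 _ := T.left_unit X

lemma unitApp_multApp_assoc {X Z : E} (h : T.obj X ⟶ Z) :
    unitApp T (T.obj X) ≫ multApp T X ≫ h = h := by
  rw [← Category.assoc, unitApp_multApp, Category.id_comp]

lemma unitApp_alg (c : T.Algebra) : unitApp T c.A ≫ c.a = 𝟙 _ := c.unit

lemma multApp_alg (c : T.Algebra) : multApp T c.A ≫ c.a = T.map c.a ≫ c.a := c.assoc

end MonadLemmas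

/-! ### Partial algebras: colimits, and one step towards an algebra -/

/-- A partial algebra for an endofunctor: an action on `left` with values in `right`. -/
structure PreAlg {E : Type u} [Category.{v} E] (T : E ⥤ E) where
  /-- the carrier -/
  left : E
  /-- the object of values -/
  right : E
  /-- the action -/
  act : T.obj left ⟶ right

namespace PreAlg

open SmallObject

variable {E : Type u} [Category.{v} E]

/-- A morphism of partial algebras. -/
@[ext]
structure Hom {T : E ⥤ E} (Y Z : PreAlg T) where
  /-- the map of carriers -/
  left : Y.left ⟶ Z.left
  /-- the map of values -/
  right : Y.right ⟶ Z.right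
  comm : T.map left ≫ Z.act = Y.act ≫ right

lemma Hom.comm_assoc {T : E ⥤ E} {Y Z : PreAlg T} (f : Hom Y Z) {W : E} (h : Z.right ⟶ W) :
    T.map f.left ≫ Z.act ≫ h = Y.act ≫ f.right ≫ h := by
  rw [← Category.assoc, f.comm, Category.assoc]

instance (T : E ⥤ E) : Category.{v} (PreAlg T) where
  Hom := Hom
  id Y := ⟨𝟙 _, 𝟙 _, by simp⟩
  comp f g := ⟨f.left ≫ g.left, f.right ≫ g.right, by simp [Hom.comm, Hom.comm_assoc]⟩

section

variable {T : E ⥤ E} {Y Z W : PreAlg T}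

lemma hom_ext {f g : Y ⟶ Z} (h : Hom.left f = Hom.left g) (h' : Hom.right f = Hom.right g) :
    f = g :=
  Hom.ext h h'

@[simp] lemma id_right (Y : PreAlg T) : Hom.right (𝟙 Y) = 𝟙 _ := rfl

@[simp] lemma comp_left (f : Y ⟶ Z) (g : Z ⟶ W) : Hom.left (f ≫ g) = Hom.left f ≫ Hom.left g := rfl

@[simp] lemma comp_right (f : Y ⟶ Z) (g : Z ⟶ W) :
    Hom.right (f ≫ g) = Hom.right f ≫ Hom.right g := rfl

variable (T)

/-- The carrier functor. -/
@[simps]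
def leftFunctor : PreAlg T ⥤ E where
  obj Y := Y.left
  map f := Hom.left f

/-- The functor of values. -/
@[simps]
def rightFunctor : PreAlg T ⥤ E where
  obj Y := Y.right
  map f := Hom.right f

/-- The action, as a natural transformation. -/
@[simps]
def actTrans : leftFunctor T ⋙ T ⟶ rightFunctor T where
  app Y := Y.act
  naturality _ _ f := Hom.comm f

end

section Cocomplete

variable {J : Type v} [SmallCategory J] {T : E ⥤ E} (F : J ⥤ PreAlg T)

section

variable {F} (c₀ : Cocone (F ⋙ leftFunctor T)) (c₁ : Cocone (F ⋙ rightFunctor T))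
  (a : T.obj c₀.pt ⟶ c₁.pt)
  (ha : ∀ j, T.map (c₀.ι.app j) ≫ a = (F.obj j).act ≫ c₁.ι.app j)

/-- A cocone of partial algebras, from cocones of carriers and of values. -/
@[simps]
def mkCocone : Cocone F where
  pt := ⟨c₀.pt, c₁.pt, a⟩
  ι :=
    { app := fun j => ⟨c₀.ι.app j, c₁.ι.app j, ha j⟩
      naturality := fun _ _ f => hom_ext (c₀.ι.naturality f) (c₁.ι.naturality f) }

/-- A colimit cocone of partial algebras, from a colimit cocone of carriers and a cocone of values
which is universal given the action. -/
noncomputable def mkCoconeIsColimit (h₀ : IsColimit c₀)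
    (exists_desc : ∀ (s : Cocone (F ⋙ rightFunctor T)) (b : T.obj c₀.pt ⟶ s.pt),
      (∀ j, T.map (c₀.ι.app j) ≫ b = (F.obj j).act ≫ s.ι.app j) →
        ∃ d : c₁.pt ⟶ s.pt, (∀ j, c₁.ι.app j ≫ d = s.ι.app j) ∧ a ≫ d = b)
    (uniq : ∀ (W : E) (f g : c₁.pt ⟶ W), (∀ j, c₁.ι.app j ≫ f = c₁.ι.app j ≫ g) →
      a ≫ f = a ≫ g → f = g) : IsColimit (mkCocone c₀ c₁ a ha) := by
  have key (s : Cocone F) : ∃ d : c₁.pt ⟶ s.pt.right,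
      (∀ j, c₁.ι.app j ≫ d = Hom.right (s.ι.app j)) ∧
        a ≫ d = T.map (h₀.desc ((leftFunctor T).mapCocone s)) ≫ s.pt.act :=
    exists_desc ((rightFunctor T).mapCocone s) _ fun j => by
      refine (T.map_comp_assoc _ _ _).symm.trans ?_
      exact (congrArg (fun q => T.map q ≫ s.pt.act) (h₀.fac _ j)).trans (Hom.comm (s.ι.app j))
  choose d hd hd' using key
  exact
    { desc := fun s => ⟨h₀.desc ((leftFunctor T).mapCocone s), d s, (hd' s).symm⟩
      fac := fun s j => hom_ext (h₀.fac _ j) (hd s j)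
      uniq := fun s m hm => by
        have h : Hom.left m = h₀.desc ((leftFunctor T).mapCocone s) :=
          h₀.uniq ((leftFunctor T).mapCocone s) (Hom.left m) fun j => congrArg Hom.left (hm j)
        refine hom_ext h (uniq _ _ _ (fun j => ?_) ?_)
        · exact (congrArg Hom.right (hm j)).trans (hd s j).symm
        · refine (Hom.comm m).symm.trans (Eq.trans ?_ (hd' s).symm)
          exact congrArg (fun q => T.map q ≫ s.pt.act) h }

end

/-- The canonical morphism from the colimit of the `T Yⱼ` to the colimit of the values. -/
noncomputable def colimAct [HasColimitsOfShape J E] :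
    colimit (F ⋙ leftFunctor T ⋙ T) ⟶ colimit (F ⋙ rightFunctor T) :=
  colim.map (Functor.whiskerLeft F (actTrans T))

lemma ι_colimAct [HasColimitsOfShape J E] (j : J) :
    colimit.ι (F ⋙ leftFunctor T ⋙ T) j ≫ colimAct F =
      (F.obj j).act ≫ colimit.ι (F ⋙ rightFunctor T) j :=
  ι_colimMap _ j

lemma ι_colimAct_assoc [HasColimitsOfShape J E] (j : J) {W : E}
    (h : colimit (F ⋙ rightFunctor T) ⟶ W) :
    colimit.ι (F ⋙ leftFunctor T ⋙ T) j ≫ colimAct F ≫ h =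
      ((F.obj j).act ≫ colimit.ι (F ⋙ rightFunctor T) j) ≫ h :=
  (Category.assoc _ _ _).symm.trans (congrArg (· ≫ h) (ι_colimAct F j))

/-- The canonical morphism from the colimit of the `T Yⱼ` to the image of the colimit. -/
noncomputable def colimPost [HasColimitsOfShape J E] : colimit (F ⋙ leftFunctor T ⋙ T) ⟶
    T.obj (colimit (F ⋙ leftFunctor T)) :=
  colimit.post (F ⋙ leftFunctor T) T

lemma ι_colimPost [HasColimitsOfShape J E] (j : J) :
    colimit.ι (F ⋙ leftFunctor T ⋙ T) j ≫ colimPost F =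
      T.map (colimit.ι (F ⋙ leftFunctor T) j) :=
  colimit.ι_post (F ⋙ leftFunctor T) T j

lemma ι_colimPost_assoc [HasColimitsOfShape J E] (j : J) {W : E}
    (h : T.obj (colimit (F ⋙ leftFunctor T)) ⟶ W) :
    colimit.ι (F ⋙ leftFunctor T ⋙ T) j ≫ colimPost F ≫ h =
      T.map (colimit.ι (F ⋙ leftFunctor T) j) ≫ h :=
  (Category.assoc _ _ _).symm.trans (congrArg (· ≫ h) (ι_colimPost F j))

/-- The colimit must carry an action of all of `T (colim Yⱼ)`, not only of `colim (T Yⱼ)`. Its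
values are therefore the pushout of `colimPost` and `colimAct`, which adds the missing part freely.
-/
instance hasColimitsOfShape [HasColimitsOfShape J E] [HasPushouts E] :
    HasColimitsOfShape J (PreAlg T) where
  has_colimit F := by
    let i := pushout.inl (colimPost F) (colimAct F)
    let k := pushout.inr (colimPost F) (colimAct F)
    have hik : colimPost F ≫ i = colimAct F ≫ k := pushout.condition
    let c₁ := (colimit.cocone (F ⋙ rightFunctor T)).extend k
    have hc₁ (j : J) : c₁.ι.app j = colimit.ι (F ⋙ rightFunctor T) j ≫ k := rfl
    refine ⟨_, mkCoconeIsColimit (colimit.cocone (F ⋙ leftFunctor T)) c₁ i (fun j => ?_)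
      (colimit.isColimit _) (fun s b hb => ⟨pushout.desc b (colimit.desc _ s) ?_,
        fun j => ?_, pushout.inl_desc _ _ _⟩) (fun W f g h h' => ?_)⟩
    · refine (ι_colimPost_assoc F j i).symm.trans ?_
      refine (congrArg (_ ≫ ·) hik).trans ((ι_colimAct_assoc F j k).trans ?_)
      exact Category.assoc _ _ _
    · refine colimit.hom_ext fun j => ?_
      refine (ι_colimPost_assoc F j b).trans (Eq.trans ?_ (ι_colimAct_assoc F j _).symm)
      refine ((hb j).trans ?_).trans (Category.assoc _ _ _).symm
      exact congrArg ((F.obj j).act ≫ ·) (colimit.ι_desc s j).symm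
    · rw [hc₁, Category.assoc, pushout.inr_desc, colimit.ι_desc]
    · refine pushout.hom_ext h' (colimit.hom_ext fun j => ?_)
      simpa [hc₁] using h j

instance [HasColimitsOfSize.{v, v} E] : HasColimitsOfSize.{v, v} (PreAlg T) where
  has_colimits_of_shape _ _ := inferInstance

variable [HasColimitsOfShape J E] [PreservesColimitsOfShape J T]

/-- The colimit of partial algebras whose carriers have a colimit preserved by the endofunctor. -/
noncomputable def preservedCocone : Cocone F :=
  mkCocone (colimit.cocone (F ⋙ leftFunctor T)) (colimit.cocone (F ⋙ rightFunctor T))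
    ((isColimitOfPreserves T (colimit.isColimit (F ⋙ leftFunctor T))).desc
      ((Cocone.precompose (Functor.whiskerLeft F (actTrans T))).obj
        (colimit.cocone (F ⋙ rightFunctor T))))
    fun j => (isColimitOfPreserves T (colimit.isColimit (F ⋙ leftFunctor T))).fac _ j

/-- The cocone `preservedCocone` is a colimit. -/
noncomputable def preservedCoconeIsColimit : IsColimit (preservedCocone F) :=
  mkCoconeIsColimit _ _ _ _ (colimit.isColimit _) (fun s b hb => ⟨colimit.desc _ s,
    colimit.ι_desc s, (isColimitOfPreserves T (colimit.isColimit (F ⋙ leftFunctor T))).hom_ext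
      fun j => by
        refine ((isColimitOfPreserves T (colimit.isColimit (F ⋙ leftFunctor T))).fac_assoc
          _ j _).trans (Eq.trans ?_ (hb j).symm)
        refine (Category.assoc _ _ _).trans ?_
        exact congrArg ((F.obj j).act ≫ ·) (colimit.ι_desc s j)⟩)
    (fun _ _ _ h _ => colimit.hom_ext h)

/-- When `T` preserves the shape no pushout is needed: `preservedCocone` is computed componentwise.
-/
instance : PreservesColimitsOfShape J (leftFunctor T) where
  preservesColimit {F} := preservesColimit_of_preserves_colimit_cocone
    (preservedCoconeIsColimit F) (IsColimit.ofIsoColimit (colimit.isColimit (F ⋙ leftFunctor T))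
      (Cocone.ext (Iso.refl _) fun _ => Category.comp_id _))

instance : PreservesColimitsOfShape J (rightFunctor T) where
  preservesColimit {F} := preservesColimit_of_preserves_colimit_cocone
    (preservedCoconeIsColimit F) (IsColimit.ofIsoColimit (colimit.isColimit (F ⋙ rightFunctor T))
      (Cocone.ext (Iso.refl _) fun _ => Category.comp_id _))

end Cocomplete

section Succ

variable (T : Monad E)

/-- An algebra, seen as a partial algebra. -/
abbrev ofAlg (c : T.Algebra) : PreAlg T.toFunctor := ⟨c.A, c.A, c.a⟩

/-- The inclusion of algebras into partial algebras. -/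
@[simps]
def ofAlgebra : T.Algebra ⥤ PreAlg T.toFunctor where
  obj c := ofAlg T c
  map f := ⟨f.f, f.f, f.h⟩

variable {T}

/-- The canonical morphism between the two components. -/
def link (Y : PreAlg T.toFunctor) : Y.left ⟶ Y.right := unitApp T Y.left ≫ Y.act

lemma link_def (Y : PreAlg T.toFunctor) : link Y = unitApp T Y.left ≫ Y.act := rfl

lemma link_naturality {Y Z : PreAlg T.toFunctor} (f : Y ⟶ Z) :
    link Y ≫ Hom.right f = Hom.left f ≫ link Z := by
  rw [link, link, Category.assoc, ← Hom.comm f, unitApp_naturality_assoc]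

lemma link_naturality_assoc {Y Z : PreAlg T.toFunctor} (f : Y ⟶ Z) {W : E} (h : Z.right ⟶ W) :
    link Y ≫ Hom.right f ≫ h = Hom.left f ≫ link Z ≫ h := by
  rw [← Category.assoc, link_naturality, Category.assoc]

/-- The link of an algebra is the identity, by its unit law. Hence a morphism to an algebra is
determined by its component on values. -/
lemma link_comp_right {Y : PreAlg T.toFunctor} {c : T.Algebra} (f : Y ⟶ ofAlg T c) :
    link Y ≫ Hom.right f = Hom.left f := by
  rw [link_naturality, link_def, unitApp_alg, Category.comp_id]

instance : (ofAlgebra T).Faithful where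
  map_injective h := Monad.Algebra.Hom.ext (congrArg Hom.left h)

instance : (ofAlgebra T).Full where
  map_surjective {b c} (f : ofAlg T b ⟶ ofAlg T c) := by
    have h : Hom.left f = Hom.right f := by
      rw [← link_comp_right f, link_def, unitApp_alg, Category.id_comp]
    exact ⟨⟨Hom.left f, (Hom.comm f).trans (congrArg _ h.symm)⟩, hom_ext rfl h⟩

variable [HasCoequalizers E] (Y : PreAlg T.toFunctor)

/-- One step towards an algebra: the values become the carrier, and the new values are the
universal recipient of an associative action. -/
noncomputable abbrev succ : PreAlg T.toFunctor where
  left := Y.right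
  right := coequalizer (T.map Y.act) (multApp T Y.left ≫ T.map (link Y))
  act := coequalizer.π (T.map Y.act) (multApp T Y.left ≫ T.map (link Y))

lemma succ_condition : T.map Y.act ≫ (succ Y).act =
    multApp T Y.left ≫ T.map (link Y) ≫ (succ Y).act :=
  (coequalizer.condition (T.map Y.act) (multApp T Y.left ≫ T.map (link Y))).trans
    (Category.assoc _ _ _)

lemma succ_condition_assoc {W : E} (h : (succ Y).right ⟶ W) : T.map Y.act ≫ (succ Y).act ≫ h =
    multApp T Y.left ≫ T.map (link Y) ≫ (succ Y).act ≫ h := by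
  rw [← Category.assoc, succ_condition, Category.assoc, Category.assoc]

/-- The canonical morphism to the next step. -/
noncomputable def toSucc : Y ⟶ succ Y where
  left := link Y
  right := link (succ Y)
  comm := by
    -- Restricted along the unit at `T Y.left`, where the multiplication cancels, the associativity
    -- relation becomes compatibility with the actions.
    have h := unitApp T (T.obj Y.left) ≫= succ_condition Y
    rw [unitApp_naturality_assoc, unitApp_multApp_assoc] at h
    exact h.symm

@[simp] lemma toSucc_left : Hom.left (toSucc Y) = link Y := rfl

@[simp] lemma toSucc_right : Hom.right (toSucc Y) = link (succ Y) := rfl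

/-- Algebras do not see the passage to `succ Y`. The carrier component of an extension has to be
`Hom.right f`; it respects the relation defining `succ Y` because the action of `c` is associative,
and the component on values is then forced by the coequalizer. -/
lemma bijective_toSucc_comp (c : T.Algebra) :
    Function.Bijective (fun f : succ Y ⟶ ofAlg T c => toSucc Y ≫ f) := by
  constructor
  · intro f g h
    have h0 : Hom.left f = Hom.left g := by
      rw [← link_comp_right, ← link_comp_right]
      exact congrArg Hom.right h
    refine hom_ext h0 (coequalizer.hom_ext ?_)
    refine (Hom.comm f).symm.trans (Eq.trans ?_ (Hom.comm g))
    rw [h0]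
  · intro f
    have hw : T.map (Hom.left f) ≫ c.a = Y.act ≫ Hom.right f := Hom.comm f
    have hc : T.map Y.act ≫ T.map (Hom.right f) ≫ c.a =
        (multApp T Y.left ≫ T.map (link Y)) ≫ T.map (Hom.right f) ≫ c.a := by
      rw [Category.assoc, ← T.map_comp_assoc, ← T.map_comp_assoc, link_comp_right, ← hw,
        T.map_comp_assoc, ← multApp_alg, multApp_naturality_assoc]
    refine ⟨⟨Hom.right f, coequalizer.desc _ hc, (coequalizer.π_desc _ hc).symm⟩,
      hom_ext (link_comp_right f) ?_⟩
    rw [comp_right, toSucc_right, link_def, Category.assoc, coequalizer.π_desc,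
      unitApp_naturality_assoc, unitApp_alg, Category.comp_id]

end Succ

end PreAlg

/-! ### Convergence of the iteration and the reflection into algebras -/

namespace PreAlg

open SmallObject

variable {E : Type u} [Category.{v} E] {T : Monad E}

section Colimit

/-- The legs of a cocone of partial algebras, with plain targets. -/
def leg {J : Type v} [Category.{v} J] {T : E ⥤ E} {F : J ⥤ PreAlg T} (c : Cocone F) (j : J) :
    F.obj j ⟶ c.pt := c.ι.app j

lemma map_leg {J : Type v} [Category.{v} J] {T : E ⥤ E} {F : J ⥤ PreAlg T} (c : Cocone F)
    {j k : J} (f : j ⟶ k) : F.map f ≫ leg c k = leg c j := c.w f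

variable {J : Type v} [LinearOrder J] [SuccOrder J] [HasCoequalizers E]
  {F : J ⥤ PreAlg T.toFunctor} {c : Cocone F}
  (φ : ∀ j, F.obj (Order.succ j) ≅ succ (F.obj j))
  (hφ : ∀ j, F.map (homOfLE (Order.le_succ j)) = toSucc (F.obj j) ≫ (φ j).inv)

/-- The values at a stage of the iteration become part of the carrier. -/
noncomputable def shift (c : Cocone F) (j : J) : (F.obj j).right ⟶ c.pt.left :=
  Hom.left (φ j).inv ≫ Hom.left (leg c (Order.succ j))

-- With `shift_link`, this says that the shifts are, stage by stage, an inverse of the link of the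
-- colimit.
include hφ in
lemma link_shift (j : J) : link (F.obj j) ≫ shift φ c j = Hom.left (leg c j) := by
  have h := congrArg Hom.left (map_leg c (homOfLE (Order.le_succ j)))
  rw [hφ j] at h
  rw [← h, shift, comp_left, comp_left, toSucc_left, Category.assoc]

include hφ in
lemma map_succ_right (j : J) : Hom.right (F.map (homOfLE (Order.le_succ j))) =
    Hom.left (φ j).inv ≫ link (F.obj (Order.succ j)) := by
  rw [hφ j, comp_right, toSucc_right, link_naturality]

include hφ in
lemma shift_link (j : J) : shift φ c j ≫ link c.pt = Hom.right (leg c j) := by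
  have h := congrArg Hom.right (map_leg c (homOfLE (Order.le_succ j)))
  rw [← h, comp_right, map_succ_right φ hφ, shift, Category.assoc, Category.assoc,
    link_naturality]

include hφ in
lemma map_right_shift {j k : J} (f : j ⟶ k) :
    Hom.right (F.map f) ≫ shift φ c k = shift φ c j := by
  obtain rfl | h := eq_or_lt_of_le (leOfHom f)
  · obtain rfl : f = 𝟙 _ := Subsingleton.elim _ _
    rw [F.map_id, id_right, Category.id_comp]
  · have hf : f = homOfLE (Order.le_succ j) ≫ homOfLE (Order.succ_le_of_lt h) :=
      Subsingleton.elim _ _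
    rw [hf, F.map_comp, comp_right, map_succ_right φ hφ, Category.assoc, Category.assoc,
      link_naturality_assoc, link_shift φ hφ, shift, ← map_leg c (homOfLE (Order.succ_le_of_lt h)),
      comp_left]

variable (h₀ : IsColimit ((leftFunctor T.toFunctor).mapCocone c))
  (h₁ : IsColimit ((rightFunctor T.toFunctor).mapCocone c))
  (h₂ : IsColimit ((leftFunctor T.toFunctor ⋙ T.toFunctor ⋙ T.toFunctor).mapCocone c))

-- The shifts glue to an inverse `t` of the link of the colimit, so that carrier and values may be
-- identified, and the action followed by `t` is an algebra structure. Its unit law is `hlt`.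
include hφ h₀ h₁ h₂ in
lemma exists_algebra_iso : ∃ P : T.Algebra, Nonempty (c.pt ≅ (ofAlgebra T).obj P) := by
  obtain ⟨t, ht⟩ : ∃ t : c.pt.right ⟶ c.pt.left,
      ∀ j, Hom.right (leg c j) ≫ t = shift φ c j :=
    ⟨h₁.desc ⟨c.pt.left, ⟨fun j => shift φ c j, fun j k f =>
      (map_right_shift φ hφ f).trans (Category.comp_id _).symm⟩⟩, fun j => h₁.fac _ j⟩
  have hlt : link c.pt ≫ t = 𝟙 _ := h₀.hom_ext fun j => by
    change Hom.left (leg c j) ≫ link c.pt ≫ t = Hom.left (leg c j) ≫ 𝟙 _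
    rw [← link_naturality_assoc, ht, link_shift φ hφ, Category.comp_id]
  have htl : t ≫ link c.pt = 𝟙 _ := h₁.hom_ext fun j => by
    change Hom.right (leg c j) ≫ t ≫ link c.pt = Hom.right (leg c j) ≫ 𝟙 _
    rw [← Category.assoc, ht, shift_link φ hφ, Category.comp_id]
  have hact (j : J) : T.map (shift φ c j) ≫ c.pt.act =
      (succ (F.obj j)).act ≫ Hom.right (φ j).inv ≫ Hom.right (leg c (Order.succ j)) := by
    rw [shift, T.map_comp_assoc, Hom.comm (leg c (Order.succ j)), Hom.comm_assoc (φ j).inv]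
  -- As `T ∘ T` preserves the colimit, associativity may be tested on each stage, where it is the
  -- relation imposed in forming the next one.
  have hassoc : multApp T c.pt.left ≫ c.pt.act = T.map c.pt.act ≫ T.map t ≫ c.pt.act :=
    h₂.hom_ext fun j => by
      change T.map (T.map (Hom.left (leg c j))) ≫ multApp T c.pt.left ≫ c.pt.act =
        T.map (T.map (Hom.left (leg c j))) ≫ T.map c.pt.act ≫ T.map t ≫ c.pt.act
      have hleg : T.map (Hom.left (leg c j)) ≫ c.pt.act = T.map (link (F.obj j)) ≫
          (succ (F.obj j)).act ≫ Hom.right (φ j).inv ≫ Hom.right (leg c (Order.succ j)) := by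
        rw [← link_shift φ hφ j, T.map_comp_assoc, hact]
      rw [multApp_naturality_assoc, hleg, ← T.map_comp_assoc (T.map _), Hom.comm (leg c j),
        ← T.map_comp_assoc, Category.assoc, ht, T.map_comp_assoc, hact, succ_condition_assoc]
  let P : T.Algebra :=
    { A := c.pt.left
      a := c.pt.act ≫ t
      unit := (Category.assoc _ _ _).symm.trans hlt
      assoc := by
        change multApp T c.pt.left ≫ c.pt.act ≫ t = T.map (c.pt.act ≫ t) ≫ c.pt.act ≫ t
        rw [← Category.assoc, hassoc, T.map_comp_assoc, Category.assoc, Category.assoc] }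
  refine ⟨P, ⟨?_⟩⟩
  exact
    { hom := ⟨𝟙 _, t, by
        change T.map (𝟙 c.pt.left) ≫ c.pt.act ≫ t = c.pt.act ≫ t
        rw [T.map_id, Category.id_comp]⟩
      inv := ⟨𝟙 _, link c.pt, by
        change T.map (𝟙 c.pt.left) ≫ c.pt.act = (c.pt.act ≫ t) ≫ link c.pt
        rw [Category.assoc, htl, T.map_id, Category.id_comp, Category.comp_id]⟩
      hom_inv_id := hom_ext (Category.comp_id _) htl
      inv_hom_id := hom_ext (Category.comp_id _) hlt }

end Colimit

section Reflection

variable [HasColimitsOfSize.{v, v} E]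

/-- The successor structure whose iteration is the reflection of partial algebras into algebras. -/
noncomputable def succStruct (Y : PreAlg T.toFunctor) : SuccStruct (PreAlg T.toFunctor) where
  X₀ := Y
  succ := succ
  toSucc := toSucc

/-- The partial algebras which are algebras. -/
def isAlgebra (T : Monad E) : ObjectProperty (PreAlg T.toFunctor) :=
  fun Z => ∃ c : T.Algebra, ofAlg T c = Z

/-- Every partial algebra has a universal morphism to an algebra. -/
lemma exists_reflection (κ : Cardinal.{v}) [Fact κ.IsRegular]
    [T.toFunctor.IsCardinalAccessible κ] (Y : PreAlg T.toFunctor) :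
    ∃ (P : T.Algebra) (r : Y ⟶ (ofAlgebra T).obj P), ∀ c : T.Algebra,
      Function.Bijective fun f : (ofAlgebra T).obj P ⟶ (ofAlgebra T).obj c => r ≫ f := by
  have : Nonempty κ.ord.ToType := by simpa using Cardinal.IsRegular.ne_zero Fact.out
  have := WellFoundedLT.toOrderBot κ.ord.ToType
  have := Cardinal.noMaxOrder (Fact.elim inferInstance : κ.IsRegular).aleph0_le
  -- Every stage has a proper successor, since an infinite cardinal has limit order type.
  have hmax (j : κ.ord.ToType) : ¬ IsMax j := not_isMax j
  let Φ := succStruct Y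
  let J := κ.ord.ToType
  have : PreservesColimitsOfShape J T.toFunctor :=
    T.toFunctor.preservesColimitsOfShape_of_isCardinalAccessible κ J
  obtain ⟨P, ⟨e⟩⟩ := exists_algebra_iso (T := T) (F := Φ.iterationFunctor J)
    (c := Φ.iterationCocone J) (fun j => Φ.iterationFunctorObjSuccIso j (hmax j))
    (fun j => Φ.iterationFunctor_map_succ j (hmax j))
    (isColimitOfPreserves _ (Φ.isColimitIterationCocone J))
    (isColimitOfPreserves _ (Φ.isColimitIterationCocone J))
    (isColimitOfPreserves _ (Φ.isColimitIterationCocone J))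
  refine ⟨P, Φ.ιIteration J ≫ e.hom, fun c => ?_⟩
  -- Morphisms for which all algebras are local are closed under transfinite composition, so only
  -- the single steps `toSucc` matter.
  have hr : (isAlgebra T).isLocal (Φ.ιIteration J) := by
    refine (isAlgebra T).isLocal.transfiniteCompositionsOfShape_le J _
      ⟨(Φ.transfiniteCompositionOfShapeιIteration J).ofLE ?_⟩
    rintro Z₀ _ _ ⟨_⟩ _ ⟨c, rfl⟩
    exact bijective_toSucc_comp Z₀ c
  have he : (isAlgebra T).isLocal e.hom := (isAlgebra T).isLocal_of_isIso _
  exact (isAlgebra T).isLocal.comp_mem _ _ hr he _ ⟨c, rfl⟩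

end Reflection

end PreAlg

open PreAlg in
/-- The algebras for an accessible monad on a cocomplete category have colimits. -/
lemma hasColimits_algebra {E : Type u} [Category.{v} E] [HasColimitsOfSize.{v, v} E] (T : Monad E)
    [T.toFunctor.IsAccessible.{v}] : HasColimitsOfSize.{v, v} T.Algebra := by
  obtain ⟨κ, _, _⟩ := Functor.IsAccessible.exists_cardinal (F := T.toFunctor)
  -- The reflections assemble to a left adjoint of the full inclusion, and a reflective subcategory
  -- inherits colimits.
  have : (ofAlgebra T).IsRightAdjoint := by
    rw [Functor.isRightAdjoint_iff_leftAdjointObjIsDefined_eq_top]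
    ext Y
    obtain ⟨P, r, hr⟩ := exists_reflection κ Y
    refine iff_of_true ?_ trivial
    refine Functor.CorepresentableBy.isCorepresentable (X := P)
      { homEquiv := fun {c} => (Functor.FullyFaithful.ofFullyFaithful (ofAlgebra T)).homEquiv.trans
          (Equiv.ofBijective _ (hr c))
        homEquiv_comp := fun f g => ?_ }
    simp
  let _ : Reflective (ofAlgebra T) := { L := _, adj := Adjunction.ofIsRightAdjoint _ }
  exact ⟨fun _ _ => hasColimitsOfShape_of_reflective (ofAlgebra T)⟩

/-! ### Coequalizers, hence cocompleteness, of `V`-graphs -/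

namespace VGraph

variable {V : Type u} [Category.{v} V]

lemma onHom_congr {X Y : VGraph V} {f g : X ⟶ Y} (h : f = g) (a b : X.Ob) :
    Hom.onHom f a b = Hom.onHom g a b ≫ eqToHom (by rw [h]) := by
  subst h
  simp

section Coequalizers

variable {X Y : VGraph V} (f g : X ⟶ Y)

/-- The objects of the coequalizer of two morphisms of graphs. -/
def CoeqOb : Type v := Quot fun y y' : Y.Ob => ∃ x, Hom.onOb f x = y ∧ Hom.onOb g x = y'

/-- The projection to the objects of the coequalizer. -/
def coeqMk (y : Y.Ob) : CoeqOb f g := Quot.mk _ y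

lemma coeqMk_eq (x : X.Ob) : coeqMk f g (Hom.onOb f x) = coeqMk f g (Hom.onOb g x) :=
  Quot.sound ⟨x, rfl, rfl⟩

variable {f g} [HasColimitsOfSize.{v, v} V]

/-- The pairs of objects of `Y` over a pair of objects of the coequalizer. -/
structure CoeqPairs (q q' : CoeqOb f g) : Type v where
  /-- the first object -/
  fst : Y.Ob
  /-- the second object -/
  snd : Y.Ob
  fst_eq : coeqMk f g fst = q
  snd_eq : coeqMk f g snd = q'

/-- The pairs of objects of `X` over a pair of objects of the coequalizer. -/
structure CoeqRel (q q' : CoeqOb f g) : Type v where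
  /-- the first object -/
  fst : X.Ob
  /-- the second object -/
  snd : X.Ob
  fst_eq : coeqMk f g (Hom.onOb f fst) = q
  snd_eq : coeqMk f g (Hom.onOb f snd) = q'

/-- The inclusions into the coproduct of the homs of `Y` over a pair of objects. -/
noncomputable abbrev coeqι {q q' : CoeqOb f g} (p : CoeqPairs q q') :
    Y.hom p.fst p.snd ⟶ ∐ fun p : CoeqPairs q q' => Y.hom p.fst p.snd :=
  Sigma.ι (fun p : CoeqPairs q q' => Y.hom p.fst p.snd) p

/-- The action of `f` on the coproducts of homs. -/
noncomputable def coeqFst (q q' : CoeqOb f g) : (∐ fun p : CoeqRel q q' => X.hom p.fst p.snd) ⟶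
    ∐ fun p : CoeqPairs q q' => Y.hom p.fst p.snd :=
  Sigma.desc fun p => Hom.onHom f p.fst p.snd ≫ coeqι ⟨_, _, p.fst_eq, p.snd_eq⟩

/-- The action of `g` on the coproducts of homs. -/
noncomputable def coeqSnd (q q' : CoeqOb f g) : (∐ fun p : CoeqRel q q' => X.hom p.fst p.snd) ⟶
    ∐ fun p : CoeqPairs q q' => Y.hom p.fst p.snd :=
  Sigma.desc fun p => Hom.onHom g p.fst p.snd ≫
    coeqι ⟨_, _, (coeqMk_eq f g _).symm.trans p.fst_eq, (coeqMk_eq f g _).symm.trans p.snd_eq⟩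

/-- The homs of the coequalizer. -/
noncomputable abbrev coeqHom (q q' : CoeqOb f g) : V := coequalizer (coeqFst q q') (coeqSnd q q')

/-- The homs of `Y` map to those of the coequalizer. -/
noncomputable def coeqIncl {q q' : CoeqOb f g} (a b : Y.Ob) (ha : coeqMk f g a = q)
    (hb : coeqMk f g b = q') : Y.hom a b ⟶ coeqHom q q' :=
  coeqι ⟨a, b, ha, hb⟩ ≫
    coequalizer.π (coeqFst q q') (coeqSnd q q')

/-- `coeqIncl` is indexed by arbitrary equations `coeqMk f g a = q`, so that a transport along equal
classes only changes these proofs. -/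
lemma coeqIncl_eqToHom {q q' r r' : CoeqOb f g} (a b : Y.Ob) (ha : coeqMk f g a = q)
    (hb : coeqMk f g b = q') (h : q = r) (h' : q' = r') (e : coeqHom q q' = coeqHom r r') :
    coeqIncl a b ha hb ≫ eqToHom e = coeqIncl a b (ha.trans h) (hb.trans h') := by
  subst h h'
  simp

lemma coeqIncl_condition {q q' : CoeqOb f g} (a b : X.Ob)
    (ha : coeqMk f g (Hom.onOb f a) = q) (hb : coeqMk f g (Hom.onOb f b) = q') :
    Hom.onHom f a b ≫ coeqIncl _ _ ha hb =
      Hom.onHom g a b ≫ coeqIncl _ _ ((coeqMk_eq f g a).symm.trans ha)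
        ((coeqMk_eq f g b).symm.trans hb) := by
  have h := Sigma.ι (fun p : CoeqRel q q' => X.hom p.fst p.snd) ⟨a, b, ha, hb⟩ ≫=
    coequalizer.condition (coeqFst q q') (coeqSnd q q')
  rw [coeqFst, coeqSnd, Sigma.ι_desc_assoc, Sigma.ι_desc_assoc, Category.assoc,
    Category.assoc] at h
  exact h

lemma coeqHom_ext {q q' : CoeqOb f g} {W : V} {k l : coeqHom q q' ⟶ W}
    (h : ∀ a b ha hb, coeqIncl a b ha hb ≫ k = coeqIncl a b ha hb ≫ l) : k = l := by
  refine coequalizer.hom_ext (Sigma.hom_ext _ _ fun p => ?_)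
  obtain ⟨a, b, ha, hb⟩ := p
  have := h a b ha hb
  rwa [coeqIncl, Category.assoc, Category.assoc] at this

lemma exists_coeqHom_desc {q q' : CoeqOb f g} {W : V}
    (k : ∀ a b, coeqMk f g a = q → coeqMk f g b = q' → (Y.hom a b ⟶ W))
    (hk : ∀ a b ha hb, Hom.onHom f a b ≫ k _ _ ha hb =
      Hom.onHom g a b ≫ k _ _ ((coeqMk_eq f g a).symm.trans ha)
        ((coeqMk_eq f g b).symm.trans hb)) :
    ∃ d : coeqHom q q' ⟶ W, ∀ a b ha hb, coeqIncl a b ha hb ≫ d = k a b ha hb := by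
  refine ⟨coequalizer.desc (Sigma.desc fun p => k _ _ p.fst_eq p.snd_eq) ?_,
    fun a b ha hb => ?_⟩
  · refine Sigma.hom_ext _ _ fun p => ?_
    obtain ⟨a, b, ha, hb⟩ := p
    rw [coeqFst, coeqSnd, Sigma.ι_desc_assoc, Sigma.ι_desc_assoc, Category.assoc,
      Category.assoc, Sigma.ι_desc, Sigma.ι_desc]
    exact hk a b ha hb
  · rw [coeqIncl, Category.assoc, coequalizer.π_desc, Sigma.ι_desc]

variable (f g)

/-- The coequalizer of two morphisms of graphs. -/
noncomputable abbrev coeq : VGraph V where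
  Ob := CoeqOb f g
  hom := coeqHom

/-- The projection to the coequalizer. -/
noncomputable def coeqProj : Y ⟶ coeq f g :=
  (⟨coeqMk f g, fun a b => coeqIncl a b rfl rfl⟩ : Hom Y (coeq f g))

lemma coeqProj_condition : f ≫ coeqProj f g = g ≫ coeqProj f g := by
  refine hom_ext (coeqMk_eq f g) fun a b => ?_
  refine (congrArg (· ≫ eqToHom _) (coeqIncl_condition a b rfl rfl)).trans ?_
  refine (Category.assoc _ _ _).trans (congrArg (Hom.onHom g a b ≫ ·) ?_)
  exact coeqIncl_eqToHom _ _ _ _ (coeqMk_eq f g a) (coeqMk_eq f g b) _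

lemma exists_coeq_desc {Z : VGraph V} (h : Y ⟶ Z) (w : f ≫ h = g ≫ h) :
    ∃ d : coeq f g ⟶ Z, coeqProj f g ≫ d = h := by
  let d₀ : (coeq f g).Ob → Z.Ob := Quot.lift (Hom.onOb h) (by
    rintro _ _ ⟨x, rfl, rfl⟩
    exact congrArg (fun k => Hom.onOb k x) w)
  -- On homs, each map is assembled from all pairs of representatives of `q` and `q'`; the relation
  -- between them comes from `w`.
  have key (q q' : CoeqOb f g) : ∃ d : coeqHom (f := f) (g := g) q q' ⟶ Z.hom (d₀ q) (d₀ q'),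
      ∀ (a b : Y.Ob) (ha : coeqMk f g a = q) (hb : coeqMk f g b = q'),
      coeqIncl a b ha hb ≫ d = Hom.onHom h a b ≫ eqToHom (by subst ha hb; rfl) := by
    refine exists_coeqHom_desc (f := f) (g := g) (W := Z.hom (d₀ q) (d₀ q'))
      (fun a b ha hb => Hom.onHom h a b ≫ eqToHom (by subst ha hb; rfl)) fun a b ha hb => ?_
    have := onHom_congr w a b
    rw [comp_onHom, comp_onHom] at this
    rw [← Category.assoc, this]
    simp
  choose d hd using key
  refine ⟨(⟨d₀, d⟩ : Hom (coeq f g) Z), hom_ext (fun a => rfl) fun a b => ?_⟩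
  refine (Category.comp_id _).trans ((hd _ _ a b rfl rfl).trans (Category.comp_id _))

lemma coeq_hom_ext {Z : VGraph V} {k l : coeq f g ⟶ Z}
    (h : coeqProj f g ≫ k = coeqProj f g ≫ l) : k = l := by
  have h₀ (q : CoeqOb f g) : Hom.onOb k q = Hom.onOb l q := by
    obtain ⟨a, rfl⟩ := Quot.exists_rep q
    exact congrArg (fun k => Hom.onOb k a) h
  refine hom_ext h₀ fun q q' => coeqHom_ext fun a b ha hb => ?_
  subst ha hb
  have := onHom_congr h a b
  rw [comp_onHom, comp_onHom] at this
  refine (Category.assoc _ _ _).symm.trans ((congrArg (· ≫ eqToHom _) this).trans ?_)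
  refine (Category.assoc _ _ _).trans ?_
  exact (congrArg (_ ≫ ·) (eqToHom_trans _ _)).trans (Category.comp_id _)

instance : HasCoequalizers (VGraph V) := by
  have (X Y : VGraph V) (f g : X ⟶ Y) : HasColimit (parallelPair f g) := by
    choose d hd using fun (Z : VGraph V) (h : Y ⟶ Z) (w : f ≫ h = g ≫ h) =>
      exists_coeq_desc f g h w
    exact ⟨_, Cofork.IsColimit.mk (Cofork.ofπ (coeqProj f g) (coeqProj_condition f g))
      (fun s => d _ s.π s.condition) (fun s => hd _ s.π s.condition)
      (fun s m hm => coeq_hom_ext f g (hm.trans (hd _ s.π s.condition).symm))⟩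
  exact hasCoequalizers_of_hasColimit_parallelPair _

instance : HasColimitsOfSize.{v, v} (VGraph V) :=
  has_colimits_of_hasCoequalizers_and_coproducts

end Coequalizers

end VGraph

/-! ### Isomorphisms, disjoint unions and test graphs -/

namespace VGraph

variable {V : Type u} [Category.{v} V]

lemma eqToHom_onHom {X Y : VGraph V} (f : X ⟶ Y) {a a' b b' : X.Ob} (h : a = a') (h' : b = b') :
    eqToHom (by rw [h, h']) ≫ Hom.onHom f a' b' = Hom.onHom f a b ≫ eqToHom (by rw [h, h']) := by
  subst h h'
  simp

section Iso

variable {X Y : VGraph V}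

/-- A section `r` of `f`, at the level of homs. -/
lemma onHom_section (f : X ⟶ Y) (r : Y ⟶ X) (w : f ≫ r = 𝟙 X) (a b : X.Ob) :
    Hom.onHom f a b ≫ Hom.onHom r (Hom.onOb f a) (Hom.onOb f b) ≫
      eqToHom (by rw [← comp_onOb, ← comp_onOb, w]; rfl) = 𝟙 _ := by
  have h := onHom_congr w a b
  rw [comp_onHom, id_onHom, Category.id_comp] at h
  rw [← Category.assoc, h, eqToHom_trans, eqToHom_refl]

lemma isIso_onHom (f : X ⟶ Y) [IsIso f] (a b : X.Ob) : IsIso (Hom.onHom f a b) := by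
  have w : ∀ x, Hom.onOb (inv f) (Hom.onOb f x) = x := fun x => by
    rw [← comp_onOb, IsIso.hom_inv_id]
    rfl
  refine ⟨Hom.onHom (inv f) (Hom.onOb f a) (Hom.onOb f b) ≫ eqToHom (by rw [w, w]),
    onHom_section f (inv f) (IsIso.hom_inv_id f) a b, ?_⟩
  have h := onHom_congr (IsIso.inv_hom_id f) (Hom.onOb f a) (Hom.onOb f b)
  rw [comp_onHom, id_onHom, Category.id_comp] at h
  rw [Category.assoc, eqToHom_onHom f (w a) (w b), ← Category.assoc, h, eqToHom_trans,
    eqToHom_refl]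

lemma bijective_onOb (f : X ⟶ Y) [IsIso f] : Function.Bijective (Hom.onOb f) := by
  refine Function.bijective_iff_has_inverse.2 ⟨Hom.onOb (inv f), fun a => ?_, fun b => ?_⟩
  · rw [← comp_onOb, IsIso.hom_inv_id]
    rfl
  · rw [← comp_onOb, IsIso.inv_hom_id]
    rfl

lemma isIso_of_bijective (f : X ⟶ Y) (h : Function.Bijective (Hom.onOb f))
    (h' : ∀ a b, IsIso (Hom.onHom f a b)) : IsIso f := by
  obtain ⟨g, hg, hg'⟩ := Function.bijective_iff_has_inverse.1 h
  refine ⟨(⟨g, fun c d => eqToHom (by rw [hg', hg']) ≫ inv (Hom.onHom f (g c) (g d))⟩ : Hom Y X),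
    hom_ext hg fun a b => ?_, hom_ext hg' fun c d => ?_⟩
  · change (Hom.onHom f a b ≫ eqToHom _ ≫ inv (Hom.onHom f (g (Hom.onOb f a))
      (g (Hom.onOb f b)))) ≫ eqToHom _ = 𝟙 _
    rw [← Category.assoc, ← eqToHom_onHom f (hg a).symm (hg b).symm, Category.assoc,
      Category.assoc, IsIso.hom_inv_id_assoc, eqToHom_trans, eqToHom_refl]
  · change ((eqToHom _ ≫ inv (Hom.onHom f (g c) (g d))) ≫ Hom.onHom f (g c) (g d)) ≫
      eqToHom _ = 𝟙 _
    rw [Category.assoc, Category.assoc, IsIso.inv_hom_id_assoc, eqToHom_trans, eqToHom_refl]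

end Iso

section CoprodCriterion

variable [HasInitial V] {J : Type v} {X : J → VGraph V} {Y : VGraph V}

/-- A family of morphisms exhibiting a graph as a disjoint union: bijective on objects,
invertible on homs, with initial homs between different summands. -/
structure IsDisjointUnion (f : ∀ j, X j ⟶ Y) : Prop where
  bijective : Function.Bijective fun a : Σ j, (X j).Ob => Hom.onOb (f a.1) a.2
  isIso : ∀ j a b, IsIso (Hom.onHom (f j) a b)
  isInitial : ∀ j k a b, j ≠ k → Nonempty (IsInitial (Y.hom (Hom.onOb (f j) a) (Hom.onOb (f k) b)))

/-- An isomorphism of graphs is a bijection on objects which is invertible on homs; for the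
comparison out of the explicit coproduct these conditions split according to equal and different
summands. -/
lemma isDisjointUnion_iff_isIso (f : ∀ j, X j ⟶ Y) :
    IsDisjointUnion f ↔ IsIso (coprodDesc X f) := by
  constructor
  · intro h
    refine isIso_of_bijective _ h.bijective ?_
    rintro ⟨j, a⟩ ⟨k, b⟩
    by_cases hjk : j = k
    · subst hjk
      have := h.isIso j a b
      rw [coprodDesc_onHom_same]
      have h' : IsIso (eqToHom (coprodHom_same X j a b) ≫ Hom.onHom (f j) a b) := inferInstance
      exact h'
    · obtain ⟨i⟩ := h.isInitial j k a b hjk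
      have i' : IsInitial ((coprod X).hom ⟨j, a⟩ ⟨k, b⟩) :=
        initialIsInitial.ofIso (eqToIso (coprodHom_ne X (a := ⟨j, a⟩) (b := ⟨k, b⟩) hjk).symm)
      exact isIso_of_isInitial i' i _
  · intro h
    refine ⟨bijective_onOb (coprodDesc X f), fun j a b => ?_, fun j k a b hjk => ?_⟩
    · have := isIso_onHom (coprodDesc X f) ⟨j, a⟩ ⟨j, b⟩
      rw [coprodDesc_onHom_same] at this
      refine @IsIso.of_isIso_comp_left _ _ _ _ _ (eqToHom (coprodHom_same X j a b)) (Hom.onHom (f j) a b)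
        inferInstance this
    · have := isIso_onHom (coprodDesc X f) ⟨j, a⟩ ⟨k, b⟩
      have i' : IsInitial ((coprod X).hom ⟨j, a⟩ ⟨k, b⟩) :=
        initialIsInitial.ofIso (eqToIso (coprodHom_ne X (a := ⟨j, a⟩) (b := ⟨k, b⟩) hjk).symm)
      exact ⟨i'.ofIso (@asIso _ _ _ _ (Hom.onHom (coprodDesc X f) ⟨j, a⟩ ⟨k, b⟩) this)⟩

/-- A cofan of graphs is a coproduct if and only if it is a disjoint union. -/
lemma isDisjointUnion_iff_isColimit (f : ∀ j, X j ⟶ Y) :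
    IsDisjointUnion f ↔ Nonempty (IsColimit (Cofan.mk Y f)) := by
  rw [isDisjointUnion_iff_isIso]
  constructor
  · intro h
    exact ⟨IsColimit.ofIsoColimit (coprodIsColimit X)
      (Cofan.ext (asIso (coprodDesc X f)) fun j => coprodIncl_desc X f j)⟩
  · rintro ⟨h⟩
    have e : coprodDesc X f = ((coprodIsColimit X).coconePointUniqueUpToIso h).hom :=
      Cofan.IsColimit.hom_ext (coprodIsColimit X) _ _ fun j =>
        (coprodIncl_desc X f j).trans
          ((coprodIsColimit X).comp_coconePointUniqueUpToIso_hom h ⟨j⟩).symm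
    rw [e]
    infer_instance

end CoprodCriterion

/-- The homs of a product are detected by the projections. -/
lemma hom_ext_of_isLimit {J : Type} [HasProductsOfShape J V] {X : J → VGraph V} {Y : VGraph V}
    {π : ∀ j, Y ⟶ X j} (h : IsLimit (Fan.mk Y π)) {a b : Y.Ob} {W : V} {k l : W ⟶ Y.hom a b}
    (hkl : ∀ j, k ≫ Hom.onHom (π j) a b = l ≫ Hom.onHom (π j) a b) : k = l := by
  let e := (h.conePointUniqueUpToIso (prodIsLimit X)).hom
  have he (j : J) : e ≫ prodProj X j = π j :=
    h.conePointUniqueUpToIso_hom_comp (prodIsLimit X) ⟨j⟩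
  have : IsIso e := by dsimp only [e]; infer_instance
  have := isIso_onHom e a b
  rw [← cancel_mono (Hom.onHom e a b)]
  refine Pi.hom_ext _ _ fun j => ?_
  have hj := onHom_congr (he j) a b
  rw [comp_onHom] at hj
  change _ ≫ Hom.onHom (prodProj X j) _ _ = _ ≫ Hom.onHom (prodProj X j) _ _
  rw [Category.assoc, Category.assoc, hj, ← Category.assoc, hkl, Category.assoc]

/-- A section `e` of `r` is invertible on homs if the target is a product each of whose projections
either factors through `r` or has subterminal homs on the image of `e`. -/
lemma isIso_onHom_of_section {J : Type} [HasProductsOfShape J V] {X : J → VGraph V}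
    {Y B : VGraph V} {π : ∀ j, Y ⟶ X j} (h : IsLimit (Fan.mk Y π)) (e : B ⟶ Y) (r : Y ⟶ B)
    (w : e ≫ r = 𝟙 B)
    (hπ : ∀ j, (∃ m, π j = r ≫ m) ∨ ∀ s s' (W : V) (k l : W ⟶ (X j).hom
      (Hom.onOb (π j) (Hom.onOb e s)) (Hom.onOb (π j) (Hom.onOb e s'))), k = l)
    (s s' : B.Ob) : IsIso (Hom.onHom e s s') := by
  -- The candidate inverse is the hom map of `r`. The composite `r` then `e` is compared with the
  -- identity after each projection: either `r` absorbs it, or there is nothing to compare.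
  refine ⟨_, onHom_section e r w s s', hom_ext_of_isLimit h fun j => ?_⟩
  obtain ⟨m, hm⟩ | hj := hπ j
  · rw [onHom_congr hm, comp_onHom, Category.assoc, Category.assoc, Category.id_comp,
      ← Category.assoc (Hom.onHom r _ _), ← Category.assoc (Hom.onHom e s s')]
    have h := onHom_congr w s s'
    rw [comp_onHom, id_onHom, Category.id_comp] at h
    rw [Category.assoc, Category.assoc, Category.assoc, reassoc_of% h]
    simp
  · exact hj _ _ _ _ _

lemma subsingleton_ob_of_isTerminal [HasInitial V] {X : VGraph V} (h : IsTerminal X) :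
    Subsingleton X.Ob where
  allEq t t' := by
    have := h.hom_ext (show zero V ⟶ X from ⟨fun _ => t, fun _ _ => initial.to _⟩)
      (show zero V ⟶ X from ⟨fun _ => t', fun _ _ => initial.to _⟩)
    exact congrArg (fun f => Hom.onOb f PUnit.unit) this

lemma hom_subsingleton_of_isTerminal [HasInitial V] {X : VGraph V} (h : IsTerminal X) (t t' : X.Ob)
    {W : V} (k l : W ⟶ X.hom t t') : k = l := by
  obtain rfl : t = t' := (subsingleton_ob_of_isTerminal h).elim _ _
  -- Morphisms out of this one-object graph encode generalized elements `W ⟶ X.hom t t`.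
  let G : VGraph V := ⟨PUnit, fun _ _ => W⟩
  let f (m : W ⟶ X.hom t t) : G ⟶ X := (⟨fun _ => t, fun _ _ => m⟩ : Hom G X)
  have := onHom_congr (h.hom_ext (f k) (f l)) PUnit.unit PUnit.unit
  exact this.trans (Category.comp_id _)

/-- The morphism from the graph `0` which picks an object. -/
noncomputable def pick [HasInitial V] {X : VGraph V} (x : X.Ob) : zero V ⟶ X :=
  (⟨fun _ => x, fun _ _ => initial.to _⟩ : Hom (zero V) X)

lemma zero_hom_ext [HasInitial V] {X : VGraph V} {f g : zero V ⟶ X}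
    (h : Hom.onOb f PUnit.unit = Hom.onOb g PUnit.unit) : f = g :=
  hom_ext (fun _ => h) fun _ _ => initialIsInitial.hom_ext _ _

/-- The graph with a given set of objects and terminal homs. -/
noncomputable abbrev indiscrete [HasTerminal V] (S : Type v) : VGraph V where
  Ob := S
  hom _ _ := ⊤_ V

lemma indiscrete_hom_ext [HasTerminal V] {S : Type v} {X : VGraph V} {f g : X ⟶ indiscrete S}
    (h : ∀ a, Hom.onOb f a = Hom.onOb g a) : f = g :=
  hom_ext h fun _ _ => terminalIsTerminal.hom_ext _ _

/-- The morphism to an indiscrete graph given by a function on objects. -/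
noncomputable def toIndiscrete [HasTerminal V] {S : Type v} {X : VGraph V} (f : X.Ob → S) :
    X ⟶ indiscrete S :=
  (⟨f, fun _ _ => terminal.from _⟩ : Hom X (indiscrete S))

end VGraph

/-! ### Points of algebras and indiscrete algebras -/

section OverSet

variable {A : Type u} [Category.{v} A] (p : A ⥤ Type v)

/-- The terminal object represents the functor to sets. -/
structure ElementsArePoints [HasFiniteProducts A] : Prop where
  nonempty : Nonempty (p.obj (⊤_ A))
  subsingleton : Subsingleton (p.obj (⊤_ A))
  existsUnique : ∀ (b : A) (s : p.obj b), ∃! x : (⊤_ A) ⟶ b, Names p x s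

/-- Every set underlies an object into which morphisms are functions. -/
def HasIndiscrete : Prop :=
  ∀ S : Type v, ∃ (I : A) (e : p.obj I ≃ S), ∀ (b : A) (g : p.obj b → S),
    ∃! f : b ⟶ I, ∀ s, e (p.map f s) = g s

end OverSet

section Algebras

open VGraph

variable {V : Type u} [Category.{v} V] {T : Monad (VGraph V)} (hSet : IsOverSet T)

-- This bijectivity is all that is needed of the monad being over `Set`; working with it avoids
-- transport along equalities of object sets.
include hSet in
lemma bijective_unitApp (X : VGraph V) : Function.Bijective (Hom.onOb (unitApp T X)) := by
  have h : IsIso ((ob V).map (T.η.app X)) := by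
    rw [hSet.η_ob X]
    infer_instance
  exact (isIso_iff_bijective _).1 h

lemma onOb_map_unitApp {X Y : VGraph V} (f : X ⟶ Y) (x : X.Ob) :
    Hom.onOb (T.map f) (Hom.onOb (unitApp T X) x) = Hom.onOb (unitApp T Y) (Hom.onOb f x) :=
  congrArg (fun k => Hom.onOb k x) (unitApp_naturality T f)

lemma onOb_act_unitApp (c : T.Algebra) (x : c.A.Ob) :
    Hom.onOb c.a (Hom.onOb (unitApp T c.A) x) = x :=
  congrArg (fun k => Hom.onOb k x) (unitApp_alg T c)

-- The action inverts the unit on objects. The algebra laws are equations between morphisms to an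
-- indiscrete graph, so they hold as soon as they hold on objects.
include hSet in
lemma exists_indiscrete_algebra [HasTerminal V] (S : Type v) :
    ∃ I : T.Algebra, I.A = indiscrete S := by
  obtain ⟨r, hr, hr'⟩ := Function.bijective_iff_has_inverse.1
    (bijective_unitApp hSet (indiscrete S))
  refine ⟨⟨indiscrete S, toIndiscrete r, indiscrete_hom_ext hr, indiscrete_hom_ext fun y => ?_⟩,
    rfl⟩
  -- Each object of `T (T S)` is a unit applied twice, which computes both sides of associativity.
  obtain ⟨y, rfl⟩ := (bijective_unitApp hSet _).2 y
  obtain ⟨y, rfl⟩ := (bijective_unitApp hSet _).2 y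
  have h := congrArg (fun k => Hom.onOb k (Hom.onOb (unitApp T (indiscrete S)) y))
    (unitApp_multApp T (indiscrete S))
  change r (Hom.onOb (multApp T _) _) = r (Hom.onOb (T.map (toIndiscrete r)) _)
  rw [onOb_map_unitApp]
  refine (congrArg r h).trans ?_
  exact (hr y).trans ((congrArg _ (congrArg _ (hr y))).trans (hr y)).symm

include hSet in
lemma hasIndiscrete_algOb [HasTerminal V] : HasIndiscrete (algOb T) := by
  intro S
  obtain ⟨⟨_, a, h, h'⟩, rfl⟩ := exists_indiscrete_algebra hSet S
  refine ⟨⟨indiscrete S, a, h, h'⟩, Equiv.refl S, fun b g => ⟨⟨toIndiscrete g,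
    indiscrete_hom_ext fun y => ?_⟩, fun _ => rfl, fun f hf => ?_⟩⟩
  · obtain ⟨y, rfl⟩ := (bijective_unitApp hSet _).2 y
    rw [comp_onOb, comp_onOb, onOb_map_unitApp, onOb_act_unitApp]
    exact congrArg g (onOb_act_unitApp b y).symm
  · exact Monad.Algebra.Hom.ext (indiscrete_hom_ext hf)

variable [HasInitial V]

/-- The free algebra on the graph `0` is terminal, for a well-pointed monad. -/
lemma nonempty_isTerminal_free (hT : IsWellPointed T) :
    Nonempty (IsTerminal (T.free.obj (zero V))) :=
  hT.map fun h => IsTerminal.isTerminalOfObj T.forget _ h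

lemma free_zero_hom_ext {c : T.Algebra} {f g : T.free.obj (zero V) ⟶ c}
    (h : Hom.onOb f.f (Hom.onOb (unitApp T (zero V)) PUnit.unit) =
      Hom.onOb g.f (Hom.onOb (unitApp T (zero V)) PUnit.unit)) : f = g :=
  (T.adj.homEquiv (zero V) c).injective (zero_hom_ext h)

lemma exists_free_zero_hom {c : T.Algebra} (s : c.A.Ob) : ∃ f : T.free.obj (zero V) ⟶ c,
    Hom.onOb f.f (Hom.onOb (unitApp T (zero V)) PUnit.unit) = s :=
  ⟨(T.adj.homEquiv (zero V) c).symm (pick s), congrArg (fun k : zero V ⟶ c.A => Hom.onOb k PUnit.unit)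
    ((T.adj.homEquiv (zero V) c).apply_symm_apply (pick s))⟩

/-- The underlying graph of the terminal algebra is terminal. -/
noncomputable def isTerminalForget [HasFiniteProducts T.Algebra] : IsTerminal (⊤_ T.Algebra).A :=
  IsTerminal.isTerminalObj T.forget _ terminalIsTerminal

/-- By adjunction the free algebra on `0` represents the set of objects, and by well-pointedness it
is the terminal algebra. -/
lemma elementsArePoints_algOb [HasFiniteProducts T.Algebra] (hT : IsWellPointed T) :
    ElementsArePoints (algOb T) := by
  obtain ⟨ht⟩ := nonempty_isTerminal_free hT
  let i : T.free.obj (zero V) ≅ ⊤_ T.Algebra := ht.uniqueUpToIso terminalIsTerminal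
  let t₀ : (⊤_ T.Algebra).A.Ob := Hom.onOb i.hom.f (Hom.onOb (unitApp T (zero V)) PUnit.unit)
  have hsub : Subsingleton (⊤_ T.Algebra).A.Ob := subsingleton_ob_of_isTerminal isTerminalForget
  refine ⟨⟨t₀⟩, hsub, fun b s => ?_⟩
  obtain ⟨f, hf⟩ := exists_free_zero_hom (T := T) (c := b) s
  refine ⟨i.inv ≫ f, ⟨t₀, ?_⟩, ?_⟩
  · have : i.hom ≫ i.inv ≫ f = f := by simp
    exact (congrArg (fun k : T.free.obj (zero V) ⟶ b => Hom.onOb k.f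
      (Hom.onOb (unitApp T (zero V)) PUnit.unit)) this).trans hf
  · rintro x ⟨t, hx⟩
    obtain rfl : t = t₀ := hsub.elim _ _
    rw [← cancel_epi i.hom, i.hom_inv_id_assoc]
    exact free_zero_hom_ext (hx.trans hf.symm)

end Algebras

open VGraph

/-! ### Projections and insertions for the objects of the pushout diagram -/

section Span

variable {A : Type u} [Category.{v} A] [HasFiniteProducts A] [HasCoproducts.{v} A]

section

variable (b : A)

/-- The inclusions of the points in the copower of the terminal object by the points of `b`. -/
noncomputable def discIncl (x : (⊤_ A) ⟶ b) : (⊤_ A) ⟶ disc b :=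
  Sigma.ι (fun _ : (⊤_ A) ⟶ b => ⊤_ A) x

@[simp]
lemma discIncl_discι (x : (⊤_ A) ⟶ b) : discIncl b x ≫ discι b = x :=
  Sigma.ι_desc _ _

lemma discIncl_injective : Function.Injective (discIncl b) := fun x y h => by
  rw [← discIncl_discι b x, h, discIncl_discι]

end

variable {n : ℕ} (a : Fin n → A)

lemma point_π (x : ∀ i, (⊤_ A) ⟶ a i) (i : Fin n) :
    point a x ≫ Pi.π (fun i => disc (a i)) i = discIncl (a i) (x i) :=
  Pi.lift_π _ _

variable (j : Fin n)

lemma repl_self : repl a j j = a j := if_pos rfl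

variable {j} in
lemma repl_other {i : Fin n} (h : i ≠ j) : repl a j i = disc (a i) := if_neg h

/-- The projection to the distinguished factor. -/
noncomputable def projSelf : ∏ᶜ repl a j ⟶ a j :=
  Pi.π (repl a j) j ≫ eqToHom (repl_self a j)

variable {j} in
/-- The projections to the discrete factors. -/
noncomputable def projOther {i : Fin n} (h : i ≠ j) : ∏ᶜ repl a j ⟶ disc (a i) :=
  Pi.π (repl a j) i ≫ eqToHom (repl_other a h)

lemma π_self : Pi.π (repl a j) j = projSelf a j ≫ eqToHom (repl_self a j).symm := by
  simp [projSelf]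

variable {j} in
lemma π_other {i : Fin n} (h : i ≠ j) :
    Pi.π (repl a j) i = projOther a h ≫ eqToHom (repl_other a h).symm := by
  simp [projOther]

variable {a j} in
lemma prod_repl_hom_ext {W : A} {f g : W ⟶ ∏ᶜ repl a j}
    (h : f ≫ projSelf a j = g ≫ projSelf a j)
    (h' : ∀ i (hi : i ≠ j), f ≫ projOther a hi = g ≫ projOther a hi) : f = g := by
  refine Pi.hom_ext _ _ fun i => ?_
  by_cases hi : i = j
  · subst hi
    rw [π_self, ← Category.assoc, h, Category.assoc]
  · rw [π_other a hi, ← Category.assoc, h' i hi, Category.assoc]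

lemma insertAt_π_self (x : ∀ i : {i // i ≠ j}, (⊤_ A) ⟶ a i) :
    insertAt a j x ≫ Pi.π (repl a j) j = eqToHom (repl_self a j).symm :=
  (Pi.lift_π _ _).trans (dif_pos rfl)

variable {j} in
lemma insertAt_π_other (x : ∀ i : {i // i ≠ j}, (⊤_ A) ⟶ a i) {i : Fin n} (h : i ≠ j) :
    insertAt a j x ≫ Pi.π (repl a j) i =
      (terminal.from (a j) ≫ discIncl (a i) (x ⟨i, h⟩)) ≫ eqToHom (repl_other a h).symm :=
  (Pi.lift_π _ _).trans (dif_neg h)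

lemma insertAt_projSelf (x : ∀ i : {i // i ≠ j}, (⊤_ A) ⟶ a i) :
    insertAt a j x ≫ projSelf a j = 𝟙 _ := by
  rw [projSelf, ← Category.assoc, insertAt_π_self, eqToHom_trans, eqToHom_refl]

variable {j} in
lemma insertAt_projOther (x : ∀ i : {i // i ≠ j}, (⊤_ A) ⟶ a i) {i : Fin n} (h : i ≠ j) :
    insertAt a j x ≫ projOther a h = terminal.from (a j) ≫ discIncl (a i) (x ⟨i, h⟩) := by
  rw [projOther, ← Category.assoc, insertAt_π_other a x h, Category.assoc, eqToHom_trans,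
    eqToHom_refl, Category.comp_id]

lemma map_replMap_projSelf : Limits.Pi.map (replMap a j) ≫ projSelf a j =
    Pi.π (fun i => disc (a i)) j ≫ discι (a j) := by
  have h : replMap a j j = discι (a j) ≫ eqToHom (repl_self a j).symm := dif_pos rfl
  rw [projSelf, Limits.Pi.map_π_assoc, h, Category.assoc, eqToHom_trans, eqToHom_refl,
    Category.comp_id]

variable {j} in
lemma map_replMap_projOther {i : Fin n} (h : i ≠ j) :
    Limits.Pi.map (replMap a j) ≫ projOther a h = Pi.π (fun i => disc (a i)) i := by
  have h' : replMap a j i = eqToHom (repl_other a h).symm := dif_neg h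
  rw [projOther, Limits.Pi.map_π_assoc, h', eqToHom_trans, eqToHom_refl, Category.comp_id]

/-- The image of a point of `∏ᵢ aᵢ₀` in `∏ᵢ aᵢ₀|ⱼaⱼ`. -/
lemma point_map_replMap (x : ∀ i, (⊤_ A) ⟶ a i) :
    point a x ≫ Limits.Pi.map (replMap a j) = x j ≫ insertAt a j fun i => x i := by
  refine prod_repl_hom_ext ?_ fun i hi => ?_
  · rw [Category.assoc, Category.assoc, map_replMap_projSelf, insertAt_projSelf,
      ← Category.assoc, point_π, discIncl_discι, Category.comp_id]
  · rw [Category.assoc, Category.assoc, map_replMap_projOther, insertAt_projOther, point_π,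
      ← Category.assoc, terminal.hom_ext (x j ≫ terminal.from (a j)) (𝟙 _), Category.id_comp]

end Span

variable {V : Type u} [Category.{v} V] {T : Monad (VGraph V)}

/-! ### Coproducts of algebras, and distributivity -/

section Coproducts

variable [HasInitial V] [∀ J : Type v, PreservesColimitsOfShape (Discrete J) T.toFunctor]
  {J : Type v} {B : J → T.Algebra} {Y : T.Algebra} (f : ∀ j, B j ⟶ Y)

/-- A cofan of algebras is a coproduct if and only if it is a disjoint union of graphs. -/
lemma isColimit_iff_isDisjointUnion : Nonempty (IsColimit (Cofan.mk Y f)) ↔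
    IsDisjointUnion (X := fun j => (B j).A) (Y := Y.A) fun j => (f j).f := by
  rw [isDisjointUnion_iff_isColimit]
  constructor
  · rintro ⟨h⟩
    exact ⟨isColimitCofanMkObjOfIsColimit T.forget _ _ h⟩
  · rintro ⟨h⟩
    exact ⟨isColimitOfIsColimitCofanMkObj T.forget _ _ h⟩

end Coproducts

section Points

variable [HasFiniteProducts T.Algebra] (hp : ElementsArePoints (algOb T))

include hp

/-- The elements of an algebra are its global points. -/
lemma onOb_bijective_points (t : (⊤_ T.Algebra).A.Ob) (b : T.Algebra) :
    Function.Bijective fun x : (⊤_ T.Algebra) ⟶ b => Hom.onOb x.f t := by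
  refine ⟨fun x y h => ?_, fun s => ?_⟩
  · exact (hp.existsUnique b (Hom.onOb x.f t)).unique ⟨t, rfl⟩ ⟨t, h.symm⟩
  · obtain ⟨x, ⟨t', hx⟩, -⟩ := hp.existsUnique b s
    obtain rfl : t' = t := hp.subsingleton.elim _ _
    exact ⟨x, hx⟩

/-- A criterion for bijectivity on objects in terms of global points. -/
lemma bijective_of_points {J : Type v} {B : J → T.Algebra} {Y : T.Algebra} (f : ∀ j, B j ⟶ Y)
    (hinj : ∀ j k (x : (⊤_ T.Algebra) ⟶ B j) (y : (⊤_ T.Algebra) ⟶ B k),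
      x ≫ f j = y ≫ f k → ∃ h : j = k, x ≫ eqToHom (by rw [h]) = y)
    (hsurj : ∀ y : (⊤_ T.Algebra) ⟶ Y, ∃ j x, x ≫ f j = y) :
    Function.Bijective fun a : Σ j, (B j).A.Ob => Hom.onOb (f a.1).f a.2 := by
  obtain ⟨t⟩ := hp.nonempty
  refine ⟨?_, fun y => ?_⟩
  · rintro ⟨j, a⟩ ⟨k, b⟩ h
    obtain ⟨x, rfl⟩ := (onOb_bijective_points hp t (B j)).2 a
    obtain ⟨y, rfl⟩ := (onOb_bijective_points hp t (B k)).2 b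
    obtain ⟨rfl, rfl⟩ := hinj j k x y ((onOb_bijective_points hp t Y).1 h)
    simp
  · obtain ⟨y, rfl⟩ := (onOb_bijective_points hp t Y).2 y
    obtain ⟨j, x, rfl⟩ := hsurj y
    exact ⟨⟨j, Hom.onOb x.f t⟩, rfl⟩

end Points

section Distributivity

variable [HasInitial V] [∀ J : Type v, PreservesColimitsOfShape (Discrete J) T.toFunctor]
  [HasLimitsOfSize.{v, v} V]

section

variable (a : T.Algebra)

lemma isDisjointUnion_discIncl : IsDisjointUnion (X := fun _ => (⊤_ T.Algebra).A)
    (Y := (disc a).A) fun x => (discIncl a x).f :=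
  (isColimit_iff_isDisjointUnion (discIncl a)).1 ⟨coproductIsCoproduct _⟩

lemma discIncl_surjective (hp : ElementsArePoints (algOb T)) :
    Function.Surjective (discIncl a) := fun y => by
  obtain ⟨t⟩ := hp.nonempty
  obtain ⟨⟨x, t'⟩, h⟩ := (isDisjointUnion_discIncl a).bijective.2 (Hom.onOb y.f t)
  obtain rfl : t' = t := hp.subsingleton.elim _ _
  exact ⟨x, (onOb_bijective_points hp t' _).1 h⟩

/-- Inside one summand of `disc a` the homs are those of the terminal algebra. -/
lemma disc_hom_subsingleton (x : (⊤_ T.Algebra) ⟶ a) (t t' : (⊤_ T.Algebra).A.Ob) {W : V}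
    (k l : W ⟶ (disc a).A.hom (Hom.onOb (discIncl a x).f t) (Hom.onOb (discIncl a x).f t')) :
    k = l := by
  have := (isDisjointUnion_discIncl a).isIso x t t'
  rw [← cancel_mono (inv (Hom.onHom (discIncl a x).f t t'))]
  exact hom_subsingleton_of_isTerminal isTerminalForget t t' _ _

end

variable [HasStrictInitialObjects V] {n : ℕ} (X : Fin n → T.Algebra)

/-- The product of discrete algebras is the discrete algebra on the tuples of points. -/
lemma nonempty_isColimit_point (hp : ElementsArePoints (algOb T)) :
    Nonempty (IsColimit (Cofan.mk (∏ᶜ fun i => disc (X i)) (point X))) := by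
  rw [isColimit_iff_isDisjointUnion]
  have hlim : IsLimit (Fan.mk (∏ᶜ fun i => disc (X i)).A fun i => (Pi.π (fun i => disc (X i)) i).f) :=
    isLimitFanMkObjOfIsLimit T.forget _ _ (productIsProduct fun i => disc (X i))
  refine ⟨bijective_of_points hp (point X) (fun x y k l h => ?_) (fun y => ?_),
    fun x t t' => ?_, fun x y t t' h => ?_⟩
  · have hxy : x = y := funext fun i => discIncl_injective (X i) (by
      rw [← point_π, ← point_π, ← Category.id_comp (point X x), ← Category.id_comp (point X y),
        terminal.hom_ext (𝟙 _) k, h, terminal.hom_ext k l])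
    exact ⟨hxy, terminal.hom_ext _ _⟩
  · choose x hx using fun i => discIncl_surjective (X i) hp (y ≫ Pi.π (fun i => disc (X i)) i)
    refine ⟨x, 𝟙 _, Pi.hom_ext _ _ fun i => ?_⟩
    rw [Category.id_comp, point_π, hx]
  · have hπ (i : Fin n) := congrArg Monad.Algebra.Hom.f (point_π X x i)
    refine isIso_onHom_of_section hlim (point X x).f (terminal.from (∏ᶜ fun i => disc (X i)) :
      (∏ᶜ fun i => disc (X i)) ⟶ ⊤_ T.Algebra).f (congrArg Monad.Algebra.Hom.f (terminal.hom_ext (point X x ≫ terminal.from _) (𝟙 _)))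
      (fun i => Or.inr fun s s' W => ?_) t t'
    have hs (s) : Hom.onOb (Pi.π (fun i => disc (X i)) i).f (Hom.onOb (point X x).f s) =
        Hom.onOb (discIncl (X i) (x i)).f s := congrArg (fun f => Hom.onOb f s) (hπ i)
    rw [hs, hs]
    exact disc_hom_subsingleton (X i) (x i) s s'
  -- Different tuples differ at some place `i`. There the projection maps the hom to one between
  -- different summands of `disc (X i)`, which is initial; by strictness the source is initial too.
  · obtain ⟨i, hi⟩ := Function.ne_iff.1 h
    have hs (x : ∀ i, (⊤_ T.Algebra) ⟶ X i) (s) :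
        Hom.onOb (Pi.π (fun i => disc (X i)) i).f (Hom.onOb (point X x).f s) =
        Hom.onOb (discIncl (X i) (x i)).f s :=
      congrArg (fun f => Hom.onOb (Monad.Algebra.Hom.f f) s) (point_π X x i)
    obtain ⟨hinit⟩ := (isDisjointUnion_discIncl (X i)).isInitial (x i) (y i) t t' hi
    rw [← hs, ← hs] at hinit
    have := hinit.isIso_to (Hom.onHom (Pi.π (fun i => disc (X i)) i).f
      (Hom.onOb (point X x).f t) (Hom.onOb (point X y).f t'))
    exact ⟨hinit.ofIso (asIso (Hom.onHom (Pi.π (fun i => disc (X i)) i).f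
      (Hom.onOb (point X x).f t) (Hom.onOb (point X y).f t'))).symm⟩

/-- Products distribute over coproducts: the product of the discrete algebras, with one of them
replaced by the corresponding algebra, is a coproduct of copies of this algebra. -/
lemma nonempty_isColimit_insertAt (hp : ElementsArePoints (algOb T)) (j : Fin n) :
    Nonempty (IsColimit (Cofan.mk (∏ᶜ repl X j) (insertAt X j))) := by
  rw [isColimit_iff_isDisjointUnion]
  have hlim : IsLimit (Fan.mk (∏ᶜ repl X j).A fun i => (Pi.π (repl X j) i).f) :=
    isLimitFanMkObjOfIsLimit T.forget _ _ (productIsProduct (repl X j))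
  have hs (x : ∀ i : {i // i ≠ j}, (⊤_ T.Algebra) ⟶ X i) {i : Fin n} (hi : i ≠ j) (s) :
      Hom.onOb (projOther X hi).f (Hom.onOb (insertAt X j x).f s) =
        Hom.onOb (discIncl (X i) (x ⟨i, hi⟩)).f (Hom.onOb (terminal.from (X j)).f s) :=
    congrArg (fun f => Hom.onOb (Monad.Algebra.Hom.f f) s) (insertAt_projOther X x hi)
  refine ⟨bijective_of_points hp (insertAt X j) (fun x y k l h => ?_) (fun y => ?_),
    fun x t t' => ?_, fun x y t t' h => ?_⟩
  · have hxy : x = y := funext fun ⟨i, hi⟩ => discIncl_injective (X i) (by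
      have h' := congrArg (· ≫ projOther X hi) h
      simp only [Category.assoc, insertAt_projOther] at h'
      rwa [← Category.assoc, ← Category.assoc, terminal.hom_ext (k ≫ terminal.from _) (𝟙 _),
        terminal.hom_ext (l ≫ terminal.from _) (𝟙 _), Category.id_comp, Category.id_comp] at h')
    subst hxy
    have h' := congrArg (· ≫ projSelf X j) h
    simp only [Category.assoc, insertAt_projSelf, Category.comp_id] at h'
    exact ⟨rfl, (Category.comp_id _).trans h'⟩
  · choose x hx using fun i : {i // i ≠ j} =>
      discIncl_surjective (X i) hp (y ≫ projOther X i.2)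
    refine ⟨x, y ≫ projSelf X j, prod_repl_hom_ext ?_ fun i hi => ?_⟩
    · rw [Category.assoc, insertAt_projSelf, Category.comp_id]
    · rw [Category.assoc, insertAt_projOther, ← Category.assoc,
        terminal.hom_ext ((y ≫ projSelf X j) ≫ terminal.from _) (𝟙 _), Category.id_comp]
      exact hx ⟨i, hi⟩
  -- The projection at `j` factors through the retraction `projSelf`, and every other projection
  -- lands in a single summand of a discrete algebra.
  · refine isIso_onHom_of_section hlim (insertAt X j x).f (projSelf X j).f
      (congrArg Monad.Algebra.Hom.f (insertAt_projSelf X j x)) (fun i => ?_) t t'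
    by_cases hi : i = j
    · subst hi
      exact Or.inl ⟨_, congrArg Monad.Algebra.Hom.f (π_self X i)⟩
    · refine Or.inr fun s s' W k l => ?_
      have : IsIso (eqToHom (repl_other X hi)).f :=
        (inferInstance : IsIso (T.forget.map (eqToHom (repl_other X hi))))
      have := isIso_onHom (eqToHom (repl_other X hi)).f
        (Hom.onOb (Pi.π (repl X j) i).f (Hom.onOb (insertAt X j x).f s))
        (Hom.onOb (Pi.π (repl X j) i).f (Hom.onOb (insertAt X j x).f s'))
      rw [← cancel_mono (Hom.onHom (eqToHom (repl_other X hi)).f _ _)]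
      have key : ∀ (k l : W ⟶ (disc (X i)).A.hom
          (Hom.onOb (projOther X hi).f (Hom.onOb (insertAt X j x).f s))
          (Hom.onOb (projOther X hi).f (Hom.onOb (insertAt X j x).f s'))), k = l := by
        rw [hs, hs]
        exact disc_hom_subsingleton (X i) (x ⟨i, hi⟩) _ _
      exact key _ _
  · obtain ⟨⟨i, hi⟩, hne⟩ := Function.ne_iff.1 h
    obtain ⟨hinit⟩ := (isDisjointUnion_discIncl (X i)).isInitial (x ⟨i, hi⟩) (y ⟨i, hi⟩)
      (Hom.onOb (terminal.from (X j)).f t) (Hom.onOb (terminal.from (X j)).f t') hne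
    rw [← hs x hi, ← hs y hi] at hinit
    have := hinit.isIso_to (Hom.onHom (projOther X hi).f
      (Hom.onOb (insertAt X j x).f t) (Hom.onOb (insertAt X j y).f t'))
    exact ⟨hinit.ofIso (asIso (Hom.onHom (projOther X hi).f
      (Hom.onOb (insertAt X j x).f t) (Hom.onOb (insertAt X j y).f t'))).symm⟩

end Distributivity

/-! ### Multimaps, elements as points, and universality -/

section Plug

variable {ι : Type} [DecidableEq ι] {S : ι → Type v} (i : ι) (s : S i)
  (z : ∀ k : {k // k ≠ i}, S k)

lemma plug_same : plug i s z i = s := by simp [plug]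

variable {i} in
lemma plug_ne {k : ι} (h : k ≠ i) : plug i s z k = z ⟨k, h⟩ := by simp [plug, h]

lemma plug_restrict (t : ∀ k, S k) : plug i (t i) (fun k => t k) = t := by
  funext k
  by_cases h : k = i
  · subst h
    rw [plug_same]
  · rw [plug_ne _ _ h]

end Plug

variable {A : Type u} [Category.{v} A] {p : A ⥤ Type v}

namespace Multimap

@[ext]
lemma ext {ι : Type} [DecidableEq ι] {a : ι → A} {b : A} {f g : Multimap p a b}
    (h : ∀ z, f.fn z = g.fn z) (h' : ∀ i z, f.lin i z = g.lin i z) : f = g := by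
  obtain ⟨f₀, f₁, _⟩ := f
  obtain ⟨g₀, g₁, _⟩ := g
  obtain rfl : f₀ = g₀ := funext h
  obtain rfl : f₁ = g₁ := funext fun i => funext (h' i)
  rfl

/-- Composition of a multimap with a morphism. -/
@[simps]
def postcomp {ι : Type} [DecidableEq ι] {a : ι → A} {b c : A} (u : Multimap p a b) (g : b ⟶ c) :
    Multimap p a c where
  fn z := p.map g (u.fn z)
  lin i z := u.lin i z ≫ g
  lin_fn i z s := (p.map_comp_apply _ _ s).trans (congrArg (p.map g) (u.lin_fn i z s))

/-- A multimap is universal if every multimap with the same source factors uniquely through it. -/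
def Universal {ι : Type} [DecidableEq ι] {a : ι → A} {b : A} (u : Multimap p a b) : Prop :=
  ∀ c : A, Function.Bijective fun g : b ⟶ c => u.postcomp g

end Multimap

variable [HasFiniteProducts A]

namespace ElementsArePoints

variable (hp : ElementsArePoints p)

/-- The bijection between points and elements. -/
noncomputable def equiv (b : A) : ((⊤_ A) ⟶ b) ≃ p.obj b :=
  Equiv.ofBijective (fun x => p.map x hp.nonempty.some) (by
    refine ⟨fun x y h => ?_, fun s => ?_⟩
    · exact (hp.existsUnique b (p.map x hp.nonempty.some)).unique ⟨_, rfl⟩ ⟨_, h.symm⟩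
    · obtain ⟨x, ⟨t, hx⟩, -⟩ := hp.existsUnique b s
      obtain rfl : t = hp.nonempty.some := hp.subsingleton.elim _ _
      exact ⟨x, hx⟩)

lemma names_iff {b : A} (x : (⊤_ A) ⟶ b) (s : p.obj b) : Names p x s ↔ hp.equiv b x = s := by
  refine ⟨?_, fun h => ⟨_, h⟩⟩
  rintro ⟨t, h⟩
  obtain rfl : t = hp.nonempty.some := hp.subsingleton.elim _ _
  exact h

lemma equiv_comp {b c : A} (x : (⊤_ A) ⟶ b) (f : b ⟶ c) :
    hp.equiv c (x ≫ f) = p.map f (hp.equiv b x) :=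
  p.map_comp_apply _ _ _

end ElementsArePoints

variable [HasCoproducts.{v} A] {n : ℕ} {a : Fin n → A}

/-! ### Cocones on the pushout diagram as multimaps -/

section Legs

variable {P : A}

/-- The leg of a cocone on the pushout diagram at `∏ᵢ aᵢ₀`. -/
noncomputable def legNone (c : pushoutDiagram a ⟶ (Functor.const _).obj P) :
    (∏ᶜ fun i => disc (a i)) ⟶ P :=
  c.app none

/-- The leg of a cocone on the pushout diagram at `∏ᵢ aᵢ₀|ⱼaⱼ`. -/
noncomputable def legSome (c : pushoutDiagram a ⟶ (Functor.const _).obj P) (j : Fin n) :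
    ∏ᶜ repl a j ⟶ P :=
  c.app (some j)

lemma map_replMap_legSome (c : pushoutDiagram a ⟶ (Functor.const _).obj P) (j : Fin n) :
    Limits.Pi.map (replMap a j) ≫ legSome c j = legNone c :=
  (c.naturality (WidePushoutShape.Hom.init j)).trans (Category.comp_id _)

lemma cocone_ext {c d : pushoutDiagram a ⟶ (Functor.const _).obj P} (h : legNone c = legNone d)
    (h' : ∀ j, legSome c j = legSome d j) : c = d := by
  refine NatTrans.ext (funext fun j => ?_)
  cases j with
  | none => exact h
  | some j => exact h' j

lemma exists_cocone (d₀ : (∏ᶜ fun i => disc (a i)) ⟶ P) (d : ∀ j, ∏ᶜ repl a j ⟶ P)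
    (w : ∀ j, Limits.Pi.map (replMap a j) ≫ d j = d₀) :
    ∃ c : pushoutDiagram a ⟶ (Functor.const _).obj P,
      legNone c = d₀ ∧ ∀ j, legSome c j = d j :=
  ⟨(WidePushoutShape.mkCocone (F := pushoutDiagram a) (X := P) d₀ d w).ι, rfl, fun _ => rfl⟩

/-- Once elements are identified with points, the relation `Names` becomes the bijection `hp.equiv`
and the tuples `z` are determined by the tuples `x`. -/
lemma corresponds_iff (hp : ElementsArePoints p) (u : Multimap p a P)
    (c : pushoutDiagram a ⟶ (Functor.const _).obj P) : Corresponds u c ↔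
    (∀ j (x : ∀ i : {i // i ≠ j}, (⊤_ A) ⟶ a i),
      insertAt a j x ≫ legSome c j = u.lin j fun i => hp.equiv _ (x i)) ∧
    ∀ x : ∀ i, (⊤_ A) ⟶ a i,
      hp.equiv P (point a x ≫ legNone c) = u.fn fun i => hp.equiv _ (x i) := by
  constructor
  · rintro ⟨h, h'⟩
    exact ⟨fun j x => h j x _ fun i => (hp.names_iff _ _).2 rfl,
      fun x => (hp.names_iff _ _).1 (h' x _ fun i => (hp.names_iff _ _).2 rfl)⟩
  · rintro ⟨h, h'⟩
    refine ⟨fun j x z hz => ?_, fun x z hz => ?_⟩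
    · obtain rfl : (fun i => hp.equiv _ (x i)) = z := funext fun i => (hp.names_iff _ _).1 (hz i)
      exact h j x
    · obtain rfl : (fun i => hp.equiv _ (x i)) = z := funext fun i => (hp.names_iff _ _).1 (hz i)
      exact (hp.names_iff _ _).2 (h' x)

lemma Corresponds.postcomp (hp : ElementsArePoints p) {u : Multimap p a P}
    {c : pushoutDiagram a ⟶ (Functor.const _).obj P} (h : Corresponds u c) {Q : A} (g : P ⟶ Q) :
    Corresponds (u.postcomp g) (c ≫ (Functor.const _).map g) := by
  rw [corresponds_iff hp] at h ⊢
  refine ⟨fun j x => ?_, fun x => ?_⟩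
  · refine (Category.assoc _ _ _).symm.trans ?_
    exact congrArg (· ≫ g) (h.1 j x)
  · refine (congrArg (hp.equiv Q) (Category.assoc _ _ _).symm).trans ?_
    refine (hp.equiv_comp _ g).trans ?_
    exact congrArg (p.map g) (h.2 x)

end Legs

section Correspondence

variable (hp : ElementsArePoints p) {P : A}

include hp in
lemma Corresponds.multimap_ext {u u' : Multimap p a P}
    {c : pushoutDiagram a ⟶ (Functor.const _).obj P} (h : Corresponds u c)
    (h' : Corresponds u' c) : u = u' := by
  rw [corresponds_iff hp] at h h'
  refine Multimap.ext (fun z => ?_) fun j z => ?_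
  · obtain ⟨x, rfl⟩ : ∃ x, (fun i => hp.equiv _ (x i)) = z :=
      ⟨fun i => (hp.equiv _).symm (z i), funext fun i => (hp.equiv _).apply_symm_apply (z i)⟩
    exact (h.2 _).symm.trans (h'.2 _)
  · obtain ⟨x, rfl⟩ : ∃ x, (fun i => hp.equiv _ (x i)) = z :=
      ⟨fun i => (hp.equiv _).symm (z i), funext fun i => (hp.equiv _).apply_symm_apply (z i)⟩
    exact (h.1 j _).symm.trans (h'.1 j _)

/-- The tuple `plug j s z` corresponds to the point obtained by inserting `s`. -/
lemma equiv_insertAt (c : pushoutDiagram a ⟶ (Functor.const _).obj P) (j : Fin n)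
    (x : ∀ i, (⊤_ A) ⟶ a i) :
    x j ≫ insertAt a j (fun i => x i) ≫ legSome c j = point a x ≫ legNone c := by
  rw [← map_replMap_legSome c j, ← Category.assoc, ← point_map_replMap, Category.assoc]

include hp in
lemma exists_multimap (c : pushoutDiagram a ⟶ (Functor.const _).obj P) :
    ∃ u : Multimap p a P, Corresponds u c := by
  let u : Multimap p a P :=
    { fn := fun z => hp.equiv P (point a (fun i => (hp.equiv _).symm (z i)) ≫ legNone c)
      lin := fun j z => insertAt a j (fun i => (hp.equiv _).symm (z i)) ≫ legSome c j
      lin_fn := fun j z s => by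
        -- The condition `lin_fn` is the commutation of the leg at `j` with the leg at `∏ᵢ aᵢ₀`,
        -- read on points.
        rw [← equiv_insertAt c j, hp.equiv_comp]
        have h : (fun i : {i // i ≠ j} => (hp.equiv (a i)).symm
            (plug (S := fun k => p.obj (a k)) j s z i)) = fun i => (hp.equiv _).symm (z i) :=
          funext fun i => by rw [plug_ne _ _ i.2]
        rw [h, plug_same, Equiv.apply_symm_apply] }
  refine ⟨u, (corresponds_iff hp _ _).2 ⟨fun j x => ?_, fun x => ?_⟩⟩
  · simp [u]
  · simp [u]

variable (hP : Nonempty (IsColimit (Cofan.mk (∏ᶜ fun i => disc (a i)) (point a))))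
  (hI : ∀ j, Nonempty (IsColimit (Cofan.mk (∏ᶜ repl a j) (insertAt a j))))

-- The coproduct decompositions `hP` and `hI` determine each leg by the restrictions that
-- `Corresponds` prescribes.
include hp hP hI in
lemma Corresponds.cocone_ext {u : Multimap p a P}
    {c c' : pushoutDiagram a ⟶ (Functor.const _).obj P} (h : Corresponds u c)
    (h' : Corresponds u c') : c = c' := by
  rw [corresponds_iff hp] at h h'
  refine FreeProducts.cocone_ext ?_ fun j => ?_
  · exact Cofan.IsColimit.hom_ext hP.some _ _ fun x =>
      (hp.equiv P).injective ((h.2 x).trans (h'.2 x).symm)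
  · exact Cofan.IsColimit.hom_ext (hI j).some _ _ fun x => (h.1 j x).trans (h'.1 j x).symm

include hp hP hI in
lemma exists_corresponds (u : Multimap p a P) :
    ∃ c : pushoutDiagram a ⟶ (Functor.const _).obj P, Corresponds u c := by
  obtain ⟨d₀, h₀⟩ : ∃ d₀ : (∏ᶜ fun i => disc (a i)) ⟶ P, ∀ x, point a x ≫ d₀ =
      (hp.equiv P).symm (u.fn fun i => hp.equiv _ (x i)) :=
    ⟨Cofan.IsColimit.desc hP.some _, fun x => Cofan.IsColimit.fac hP.some _ x⟩
  have hd (j : Fin n) : ∃ d : ∏ᶜ repl a j ⟶ P, ∀ x, insertAt a j x ≫ d =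
      u.lin j fun i => hp.equiv _ (x i) :=
    ⟨Cofan.IsColimit.desc (hI j).some _, fun x => Cofan.IsColimit.fac (hI j).some _ x⟩
  choose d hd using hd
  -- Conversely, `lin_fn` gives the cocone condition, tested on the summands of `∏ᵢ aᵢ₀`.
  obtain ⟨c, hc₀, hc⟩ := exists_cocone d₀ d fun j => by
    refine Cofan.IsColimit.hom_ext hP.some _ _ fun x => ?_
    change point a x ≫ Limits.Pi.map (replMap a j) ≫ d j = point a x ≫ d₀
    rw [h₀, ← Category.assoc, point_map_replMap, Category.assoc, hd, Equiv.eq_symm_apply,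
      hp.equiv_comp, u.lin_fn]
    exact congrArg u.fn (plug_restrict j fun i => hp.equiv _ (x i))
  refine ⟨c, (corresponds_iff hp _ _).2 ⟨fun j x => ?_, fun x => ?_⟩⟩
  · rw [hc, hd]
  · rw [hc₀, h₀, Equiv.apply_symm_apply]

include hp hP hI in
/-- A multimap is universal if and only if the corresponding cocone is a colimit. -/
lemma Corresponds.nonempty_isColimit_iff {u : Multimap p a P}
    {c : pushoutDiagram a ⟶ (Functor.const _).obj P} (h : Corresponds u c) :
    Nonempty (IsColimit (Cocone.mk P c)) ↔ u.Universal := by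
  constructor
  · rintro ⟨hc⟩ Q
    refine ⟨fun g g' hg => ?_, fun v => ?_⟩
    · have h₁ := h.postcomp hp g
      have h₂ := h.postcomp hp g'
      rw [show u.postcomp g = u.postcomp g' from hg] at h₁
      exact hc.hom_ext fun j => NatTrans.congr_app (h₁.cocone_ext hp hP hI h₂) j
    · obtain ⟨d, hd⟩ := exists_corresponds hp hP hI v
      refine ⟨hc.desc ⟨Q, d⟩, (h.postcomp hp _).multimap_ext hp ?_⟩
      have : c ≫ (Functor.const _).map (hc.desc ⟨Q, d⟩) = d :=
        NatTrans.ext (funext fun j => hc.fac ⟨Q, d⟩ j)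
      rwa [this]
  · intro hu
    have key (s : Cocone (pushoutDiagram a)) : ∃ g : P ⟶ s.pt,
        c ≫ (Functor.const _).map g = s.ι ∧
          ∀ g' : P ⟶ s.pt, c ≫ (Functor.const _).map g' = s.ι → g' = g := by
      obtain ⟨v, hv⟩ := exists_multimap hp s.ι
      obtain ⟨g, rfl⟩ := (hu s.pt).2 v
      refine ⟨g, (h.postcomp hp g).cocone_ext hp hP hI hv, fun g' hg' => (hu s.pt).1 ?_⟩
      have := h.postcomp hp g'
      rw [hg'] at this
      exact this.multimap_ext hp hv
    choose g hg hg' using key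
    exact ⟨{ desc := g
             fac := fun s j => NatTrans.congr_app (hg s) j
             uniq := fun s m hm => hg' s m (NatTrans.ext (funext hm)) }⟩

end Correspondence

/-! ### Universal multimaps are strongly universal, and conversely -/

namespace Multimap

variable {A : Type u} [Category.{v} A] {p : A ⥤ Type v} {ι κ : Type} {y : κ → A} {a : ι → A} {P c : A}

section Tuples

/-- A tuple indexed by an option type. -/
def optTuple (q : p.obj P) (t : ∀ k, p.obj (y k)) : ∀ o : Option κ, p.obj (o.elim P y)
  | none => q
  | some k => t k

/-- A tuple indexed by an option type, with the distinguished entry missing. -/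
def optNone (t : ∀ k, p.obj (y k)) : ∀ o : {o : Option κ // o ≠ none}, p.obj (o.1.elim P y)
  | ⟨none, h⟩ => absurd rfl h
  | ⟨some k, _⟩ => t k

/-- A tuple indexed by an option type, with an ordinary entry missing. -/
def optSome {k : κ} (q : p.obj P) (t : ∀ k' : {k' // k' ≠ k}, p.obj (y k')) :
    ∀ o : {o : Option κ // o ≠ some k}, p.obj (o.1.elim P y)
  | ⟨none, _⟩ => q
  | ⟨some k', h⟩ => t ⟨k', fun e => h (congrArg some e)⟩

/-- A tuple indexed by a sum type. -/
def sumTuple (t : ∀ k, p.obj (y k)) (z : ∀ i, p.obj (a i)) : ∀ s : κ ⊕ ι, p.obj (Sum.elim y a s)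
  | Sum.inl k => t k
  | Sum.inr i => z i

/-- A tuple indexed by a sum type, with an entry on the left missing. -/
def sumInl {k : κ} (t : ∀ k' : {k' // k' ≠ k}, p.obj (y k')) (z : ∀ i, p.obj (a i)) :
    ∀ s : {s : κ ⊕ ι // s ≠ Sum.inl k}, p.obj (Sum.elim y a s.1)
  | ⟨Sum.inl k', h⟩ => t ⟨k', fun e => h (congrArg Sum.inl e)⟩
  | ⟨Sum.inr i, _⟩ => z i

/-- A tuple indexed by a sum type, with an entry on the right missing. -/
def sumInr {i : ι} (t : ∀ k, p.obj (y k)) (z : ∀ i' : {i' // i' ≠ i}, p.obj (a i')) :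
    ∀ s : {s : κ ⊕ ι // s ≠ Sum.inr i}, p.obj (Sum.elim y a s.1)
  | ⟨Sum.inl k, _⟩ => t k
  | ⟨Sum.inr i', h⟩ => z ⟨i', fun e => h (congrArg Sum.inr e)⟩

lemma exists_optTuple (w : ∀ o : Option κ, p.obj (o.elim P y)) :
    ∃ (q : p.obj P) (t : ∀ k, p.obj (y k)), optTuple q t = w :=
  ⟨w none, fun k => w (some k), funext fun o => by cases o <;> rfl⟩

lemma exists_optNone (w : ∀ o : {o : Option κ // o ≠ none}, p.obj (o.1.elim P y)) :
    ∃ t : ∀ k, p.obj (y k), optNone t = w :=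
  ⟨fun k => w ⟨some k, Option.some_ne_none k⟩, funext fun o => by
    obtain ⟨_ | k, h⟩ := o
    · exact absurd rfl h
    · rfl⟩

lemma exists_optSome {k : κ} (w : ∀ o : {o : Option κ // o ≠ some k}, p.obj (o.1.elim P y)) :
    ∃ (q : p.obj P) (t : ∀ k' : {k' // k' ≠ k}, p.obj (y k')), optSome q t = w :=
  ⟨w ⟨none, (Option.some_ne_none k).symm⟩,
    fun k' => w ⟨some k', fun e => k'.2 (Option.some_injective _ e)⟩, funext fun o => by
      obtain ⟨_ | k, h⟩ := o <;> rfl⟩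

lemma exists_sumTuple (w : ∀ s : κ ⊕ ι, p.obj (Sum.elim y a s)) :
    ∃ (t : ∀ k, p.obj (y k)) (z : ∀ i, p.obj (a i)), sumTuple t z = w :=
  ⟨fun k => w (Sum.inl k), fun i => w (Sum.inr i), funext fun s => by cases s <;> rfl⟩

lemma exists_sumInl {k : κ} (w : ∀ s : {s : κ ⊕ ι // s ≠ Sum.inl k}, p.obj (Sum.elim y a s.1)) :
    ∃ (t : ∀ k' : {k' // k' ≠ k}, p.obj (y k')) (z : ∀ i, p.obj (a i)), sumInl t z = w :=
  ⟨fun k' => w ⟨Sum.inl k', fun e => k'.2 (Sum.inl_injective e)⟩,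
    fun i => w ⟨Sum.inr i, Sum.inr_ne_inl⟩, funext fun s => by
      obtain ⟨_ | _, h⟩ := s <;> rfl⟩

lemma exists_sumInr {i : ι} (w : ∀ s : {s : κ ⊕ ι // s ≠ Sum.inr i}, p.obj (Sum.elim y a s.1)) :
    ∃ (t : ∀ k, p.obj (y k)) (z : ∀ i' : {i' // i' ≠ i}, p.obj (a i')), sumInr t z = w :=
  ⟨fun k => w ⟨Sum.inl k, Sum.inl_ne_inr⟩,
    fun i' => w ⟨Sum.inr i', fun e => i'.2 (Sum.inr_injective e)⟩, funext fun s => by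
      obtain ⟨_ | _, h⟩ := s <;> rfl⟩

end Tuples

variable [DecidableEq ι] [DecidableEq κ]

section Plug

lemma plug_optNone (q : p.obj P) (t : ∀ k, p.obj (y k)) :
    plug (S := fun o : Option κ => p.obj (o.elim P y)) none q (optNone t) = optTuple q t := by
  funext o
  cases o with
  | none => exact plug_same (S := fun o : Option κ => p.obj (o.elim P y)) none q (optNone t)
  | some k =>
    exact plug_ne (S := fun o : Option κ => p.obj (o.elim P y)) (i := none) q (optNone t)
      (Option.some_ne_none k)

lemma plug_optSome {k : κ} (q : p.obj P) (t : ∀ k' : {k' // k' ≠ k}, p.obj (y k'))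
    (s : p.obj (y k)) :
    plug (S := fun o : Option κ => p.obj (o.elim P y)) (some k) s (optSome q t) =
      optTuple q (plug (S := fun k => p.obj (y k)) k s t) := by
  funext o
  cases o with
  | none =>
    exact plug_ne (S := fun o : Option κ => p.obj (o.elim P y)) (i := some k) s
      (optSome q t) (Option.some_ne_none k).symm
  | some k' =>
    by_cases h : k' = k
    · subst h
      refine (plug_same (S := fun o : Option κ => p.obj (o.elim P y)) (some k') s _).trans ?_
      exact (plug_same (S := fun k => p.obj (y k)) k' s t).symm
    · refine (plug_ne (S := fun o : Option κ => p.obj (o.elim P y)) (i := some k) s _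
        fun e => h (Option.some_injective _ e)).trans ?_
      exact (plug_ne (S := fun k => p.obj (y k)) s t h).symm

lemma plug_sumInl {k : κ} (t : ∀ k' : {k' // k' ≠ k}, p.obj (y k')) (z : ∀ i, p.obj (a i))
    (s : p.obj (y k)) :
    plug (S := fun o : κ ⊕ ι => p.obj (Sum.elim y a o)) (Sum.inl k) s (sumInl t z) =
      sumTuple (plug (S := fun k => p.obj (y k)) k s t) z := by
  funext o
  cases o with
  | inr i =>
    exact plug_ne (S := fun o : κ ⊕ ι => p.obj (Sum.elim y a o)) (i := Sum.inl k) s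
      (sumInl t z) Sum.inr_ne_inl
  | inl k' =>
    by_cases h : k' = k
    · subst h
      refine (plug_same (S := fun o : κ ⊕ ι => p.obj (Sum.elim y a o)) (Sum.inl k') s _).trans ?_
      exact (plug_same (S := fun k => p.obj (y k)) k' s t).symm
    · refine (plug_ne (S := fun o : κ ⊕ ι => p.obj (Sum.elim y a o)) (i := Sum.inl k) s _
        fun e => h (Sum.inl_injective e)).trans ?_
      exact (plug_ne (S := fun k => p.obj (y k)) s t h).symm

lemma plug_sumInr {i : ι} (t : ∀ k, p.obj (y k)) (z : ∀ i' : {i' // i' ≠ i}, p.obj (a i'))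
    (s : p.obj (a i)) :
    plug (S := fun o : κ ⊕ ι => p.obj (Sum.elim y a o)) (Sum.inr i) s (sumInr t z) =
      sumTuple t (plug (S := fun i => p.obj (a i)) i s z) := by
  funext o
  cases o with
  | inl k =>
    exact plug_ne (S := fun o : κ ⊕ ι => p.obj (Sum.elim y a o)) (i := Sum.inr i) s
      (sumInr t z) Sum.inl_ne_inr
  | inr i' =>
    by_cases h : i' = i
    · subst h
      refine (plug_same (S := fun o : κ ⊕ ι => p.obj (Sum.elim y a o)) (Sum.inr i') s _).trans ?_
      exact (plug_same (S := fun i => p.obj (a i)) i' s z).symm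
    · refine (plug_ne (S := fun o : κ ⊕ ι => p.obj (Sum.elim y a o)) (i := Sum.inr i) s _
        fun e => h (Sum.inr_injective e)).trans ?_
      exact (plug_ne (S := fun i => p.obj (a i)) s z h).symm

end Plug

section Placed

variable (f : Multimap p (fun o : Option κ => o.elim P y) c) (u : Multimap p a P)

lemma placed_fn (t : ∀ k, p.obj (y k)) (z : ∀ i, p.obj (a i)) :
    (f.placed u).fn (sumTuple t z) = f.fn (optTuple (u.fn z) t) :=
  congrArg f.fn (funext fun o => by cases o <;> rfl)

lemma placed_lin_inl (k : κ) (t : ∀ k' : {k' // k' ≠ k}, p.obj (y k')) (z : ∀ i, p.obj (a i)) :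
    (f.placed u).lin (Sum.inl k) (sumInl t z) = f.lin (some k) (optSome (u.fn z) t) :=
  congrArg (f.lin (some k)) (funext fun o => by obtain ⟨_ | _, h⟩ := o <;> rfl)

lemma placed_lin_inr (i : ι) (t : ∀ k, p.obj (y k)) (z : ∀ i' : {i' // i' ≠ i}, p.obj (a i')) :
    (f.placed u).lin (Sum.inr i) (sumInr t z) = u.lin i z ≫ f.lin none (optNone t) :=
  congrArg (fun w => u.lin i z ≫ f.lin none w) (funext fun o => by
    obtain ⟨_ | _, h⟩ := o
    · exact absurd rfl h
    · rfl)

lemma map_lin_none (t : ∀ k, p.obj (y k)) (q : p.obj P) :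
    p.map (f.lin none (optNone t)) q = f.fn (optTuple q t) :=
  (f.lin_fn none (optNone t) q).trans (congrArg f.fn (plug_optNone q t))

variable {f u}

lemma ext_option {f' : Multimap p (fun o : Option κ => o.elim P y) c}
    (h : ∀ q t, f.fn (optTuple q t) = f'.fn (optTuple q t))
    (h' : ∀ t, f.lin none (optNone t) = f'.lin none (optNone t))
    (h'' : ∀ k q t, f.lin (some k) (optSome q t) = f'.lin (some k) (optSome q t)) : f = f' := by
  refine Multimap.ext (fun w => ?_) fun o w => ?_
  · obtain ⟨q, t, rfl⟩ := exists_optTuple w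
    exact h q t
  · cases o with
    | none =>
      obtain ⟨t, rfl⟩ := exists_optNone w
      exact h' t
    | some k =>
      obtain ⟨q, t, rfl⟩ := exists_optSome w
      exact h'' k q t

lemma ext_sum {f f' : Multimap p (Sum.elim y a) c}
    (h : ∀ t z, f.fn (sumTuple t z) = f'.fn (sumTuple t z))
    (h' : ∀ k t z, f.lin (Sum.inl k) (sumInl t z) = f'.lin (Sum.inl k) (sumInl t z))
    (h'' : ∀ i t z, f.lin (Sum.inr i) (sumInr t z) = f'.lin (Sum.inr i) (sumInr t z)) :
    f = f' := by
  refine Multimap.ext (fun w => ?_) fun s w => ?_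
  · obtain ⟨t, z, rfl⟩ := exists_sumTuple w
    exact h t z
  · cases s with
    | inl k =>
      obtain ⟨t, z, rfl⟩ := exists_sumInl w
      exact h' k t z
    | inr i =>
      obtain ⟨t, z, rfl⟩ := exists_sumInr w
      exact h'' i t z

/-- Multimaps with a distinguished variable, from their components. -/
lemma exists_option (g₀ : p.obj P → (∀ k, p.obj (y k)) → p.obj c)
    (g : (∀ k, p.obj (y k)) → (P ⟶ c)) (hg : ∀ t q, p.map (g t) q = g₀ q t)
    (l : ∀ k, p.obj P → (∀ k' : {k' // k' ≠ k}, p.obj (y k')) → (y k ⟶ c))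
    (hl : ∀ k q t s, p.map (l k q t) s = g₀ q (plug (S := fun k => p.obj (y k)) k s t)) :
    ∃ f : Multimap p (fun o : Option κ => o.elim P y) c,
      (∀ q t, f.fn (optTuple q t) = g₀ q t) ∧ (∀ t, f.lin none (optNone t) = g t) ∧
        ∀ k q t, f.lin (some k) (optSome q t) = l k q t := by
  let f : Multimap p (fun o : Option κ => o.elim P y) c :=
    { fn := fun w => g₀ (w none) fun k => w (some k)
      lin := fun o => match o with
        | none => fun w => g fun k => w ⟨some k, Option.some_ne_none k⟩
        | some k => fun w => l k (w ⟨none, (Option.some_ne_none k).symm⟩)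
            fun k' => w ⟨some k', fun e => k'.2 (Option.some_injective _ e)⟩
      lin_fn := fun o w s => by
        cases o with
        | none =>
          obtain ⟨t, rfl⟩ := exists_optNone w
          exact (hg t s).trans
            (congrArg (fun w => g₀ (w none) fun k => w (some k)) (plug_optNone s t)).symm
        | some k =>
          obtain ⟨q, t, rfl⟩ := exists_optSome w
          exact (hl k q t s).trans
            (congrArg (fun w => g₀ (w none) fun k => w (some k)) (plug_optSome q t s)).symm }
  exact ⟨f, fun _ _ => rfl, fun _ => rfl, fun _ _ _ => rfl⟩

end Placed

section Universal

variable {u : Multimap p a P}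

/-- Multimaps to an indiscrete object are arbitrary functions. Universality tested there says that
predicates on the tuples correspond, along `u.fn`, to predicates on `p.obj P`. -/
lemma Universal.bijective_fn (hu : u.Universal) (hI : HasIndiscrete p) :
    Function.Bijective u.fn := by
  obtain ⟨I, e, he⟩ := hI (ULift Prop)
  have hext (v v' : Multimap p a I) (h : ∀ z, v.fn z = v'.fn z) : v = v' := by
    refine Multimap.ext h fun i z => ?_
    refine (he _ fun s => e (v.fn (plug i s z))).unique (fun s => ?_) fun s => ?_
    · rw [v.lin_fn]
    · rw [v'.lin_fn, h]
  constructor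
  · intro z z' hz
    -- The predicate of being `z` factors through `u.fn`, so it cannot separate `z` from `z'`.
    let g (w : ∀ i, p.obj (a i)) : ULift.{v} Prop := ⟨w = z⟩
    choose l hl using fun i (w : ∀ k : {k // k ≠ i}, p.obj (a k)) =>
      (he (a i) fun s => g (plug (S := fun k => p.obj (a k)) i s w)).exists
    obtain ⟨f, hf⟩ := (hu I).2
      { fn := fun w => e.symm (g w)
        lin := l
        lin_fn := fun i w s => by rw [← hl, Equiv.symm_apply_apply] }
    have hg (w) : p.map f (u.fn w) = e.symm (g w) := congrArg (fun v => v.fn w) hf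
    have h : g z = g z' := e.symm.injective (by rw [← hg, ← hg, hz])
    exact (cast (congrArg ULift.down h) rfl : z' = z).symm
  · intro q
    obtain ⟨f, hf, -⟩ := he P fun _ => ⟨True⟩
    -- The predicates "true" and "in the range of `u.fn`" agree along `u.fn`, hence everywhere.
    obtain ⟨f', hf', -⟩ := he P fun q => ⟨q ∈ Set.range u.fn⟩
    have h : f = f' := (hu I).1 (hext _ _ fun z => e.injective (by
      refine (hf (u.fn z)).trans (Eq.trans ?_ (hf' (u.fn z)).symm)
      exact congrArg ULift.up (eq_true ⟨z, rfl⟩).symm))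
    have h' := (hf q).symm.trans ((congrArg (fun k => e (p.map k q)) h).trans (hf' q))
    exact cast (congrArg ULift.down h') trivial

/-- For fixed values `t` of the other variables, universality turns a multimap in the `a i` into a
morphism `g t : P ⟶ c`. The linear parts in the other variables depend on an element of `P` instead
of a tuple, and the bijection `u.fn` translates between the two. -/
lemma Universal.stronglyUniversal (hu : u.Universal) (hI : HasIndiscrete p) :
    u.StronglyUniversal := by
  have hfn := hu.bijective_fn hI
  refine fun m y c => ⟨fun f f' h => ?_, fun f' => ?_⟩
  · have h : f.placed u = f'.placed u := h
    have h₀ (q t) : f.fn (optTuple q t) = f'.fn (optTuple q t) := by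
      obtain ⟨z, rfl⟩ := hfn.2 q
      rw [← placed_fn, h, placed_fn]
    refine ext_option h₀ (fun t => (hu c).1 (Multimap.ext (fun z => ?_) fun i z => ?_))
      fun k q t => ?_
    · exact (map_lin_none f t _).trans ((h₀ _ t).trans (map_lin_none f' t _).symm)
    · refine (placed_lin_inr f u i t z).symm.trans ?_
      rw [h]
      exact placed_lin_inr f' u i t z
    · obtain ⟨z, rfl⟩ := hfn.2 q
      rw [← placed_lin_inl, h, placed_lin_inl]
  · let v (t : ∀ k, p.obj (y k)) : Multimap p a c :=
      { fn := fun z => f'.fn (sumTuple t z)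
        lin := fun i z => f'.lin (Sum.inr i) (sumInr t z)
        lin_fn := fun i z s => (f'.lin_fn (Sum.inr i) (sumInr t z) s).trans
          (congrArg f'.fn (plug_sumInr t z s)) }
    choose g hg using fun t => (hu c).2 (v t)
    have hg₀ (t z) : p.map (g t) (u.fn z) = f'.fn (sumTuple t z) :=
      congrArg (fun w => w.fn z) (hg t)
    have hg₁ (t i z) : u.lin i z ≫ g t = f'.lin (Sum.inr i) (sumInr t z) :=
      congrArg (fun w => w.lin i z) (hg t)
    obtain ⟨r, hr, hr'⟩ := Function.bijective_iff_has_inverse.1 hfn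
    obtain ⟨f, hf₀, hf, hf₁⟩ := exists_option (fun q t => p.map (g t) q) g (fun _ _ => rfl)
      (fun k q t => f'.lin (Sum.inl k) (sumInl t (r q))) fun k q t s => by
        refine (f'.lin_fn (Sum.inl k) (sumInl t (r q)) s).trans ?_
        refine (congrArg f'.fn (plug_sumInl t (r q) s)).trans ?_
        rw [← hg₀, hr']
    refine ⟨f, ext_sum (fun t z => ?_) (fun k t z => ?_) fun i t z => ?_⟩
    · rw [placed_fn, hf₀, hg₀]
    · rw [placed_lin_inl, hf₁, hr]
    · rw [placed_lin_inr, hf, hg₁]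

lemma StronglyUniversal.universal (hu : u.StronglyUniversal) : u.Universal := by
  intro c
  -- With no further variables, placed composition is `postcomp` up to the index types `Option (Fin
  -- 0)` and `Fin 0 ⊕ ι`; the rest is this reindexing.
  have hc := hu 0 (fun k => k.elim0) c
  refine ⟨fun g g' h => ?_, fun v => ?_⟩
  · have h : u.postcomp g = u.postcomp g' := h
    have key (g : P ⟶ c) := exists_option (y := fun k : Fin 0 => (k.elim0 : A))
      (fun q _ => p.map g q) (fun _ => g) (fun _ _ => rfl) (fun k => k.elim0) (fun k => k.elim0)
    obtain ⟨f, hf₀, hf, -⟩ := key g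
    obtain ⟨f', hf₀', hf', -⟩ := key g'
    have hff : f = f' := hc.1 (ext_sum (fun t z => by
        rw [placed_fn, placed_fn, hf₀, hf₀']
        exact congrArg (fun w => w.fn z) h) (fun k => k.elim0) fun i t z => by
        rw [placed_lin_inr, placed_lin_inr, hf, hf']
        exact congrArg (fun w => w.lin i z) h)
    rw [← hf fun k => k.elim0, hff, hf']
  · let v' : Multimap p (Sum.elim (fun k : Fin 0 => (k.elim0 : A)) a) c :=
      { fn := fun t => v.fn fun i => t (Sum.inr i)
        lin := fun s => match s with
          | Sum.inl k => k.elim0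
          | Sum.inr i => fun w =>
            v.lin i fun i' => w ⟨Sum.inr i', fun e => i'.2 (Sum.inr_injective e)⟩
        lin_fn := fun s w x => by
          cases s with
          | inl k => exact k.elim0
          | inr i =>
            obtain ⟨t, z, rfl⟩ := exists_sumInr w
            exact (v.lin_fn i z x).trans
              (congrArg (fun w => v.fn fun i => w (Sum.inr i)) (plug_sumInr t z x)).symm }
    obtain ⟨f, hf⟩ := hc.2 v'
    have hf : f.placed u = v' := hf
    refine ⟨f.lin none (optNone fun k => k.elim0), Multimap.ext (fun z => ?_) fun i z => ?_⟩
    · refine (map_lin_none f _ _).trans ?_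
      rw [← placed_fn, hf]
      rfl
    · refine (placed_lin_inr f u i _ z).symm.trans ?_
      rw [hf]
      rfl

end Universal

end Multimap

end FreeProducts

theorem mainTheorem9 {V : Type u} [Category.{v} V] [IsLocallyPresentable.{v} V]
    [HasStrictInitialObjects V] (T : Monad (VGraph V)) (hSet : IsOverSet T)
    [T.toFunctor.IsAccessible.{v}]
    [∀ J : Type v, PreservesColimitsOfShape (Discrete J) T.toFunctor]
    (hT : IsWellPointed T) (n : ℕ) (X : Fin n → T.Algebra) :
    (∃ (P : T.Algebra) (u : Multimap (algOb T) X P), u.StronglyUniversal) ∧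
    ∀ (P : T.Algebra) (u : Multimap (algOb T) X P), u.StronglyUniversal →
      ∃ c : pushoutDiagram X ⟶ (Functor.const _).obj P,
        Nonempty (IsColimit (Cocone.mk P c)) ∧ Corresponds u c := by
  have hp := elementsArePoints_algOb hT
  have hP := nonempty_isColimit_point X hp
  have hI := fun j => nonempty_isColimit_insertAt X hp j
  refine ⟨?_, fun P u hu => ?_⟩
  · have := hasColimits_algebra T
    -- The shape `WidePushoutShape (Fin n)` lives in universe `0`.
    have : HasColimitsOfSize.{0, 0} T.Algebra := hasColimitsOfSizeShrink.{0, 0, v, v} T.Algebra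
    obtain ⟨u, hu⟩ := exists_multimap hp (colimit.cocone (pushoutDiagram X)).ι
    have hu' := (hu.nonempty_isColimit_iff hp hP hI).1 ⟨colimit.isColimit (pushoutDiagram X)⟩
    exact ⟨_, u, hu'.stronglyUniversal (hasIndiscrete_algOb hSet)⟩
  · obtain ⟨c, hc⟩ := exists_corresponds hp hP hI u
    exact ⟨c, (hc.nonempty_isColimit_iff hp hP hI).2 hu.universal, hc⟩
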